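/- Let $\Sigma\rightrightarrows M$ be a symplectic groupoid: a (finite-dimensional, real, smooth) Lie groupoid with source $\mathsf s$, target $\mathsf t$ (composable pairs $\Sigma_2=\{(\gamma,\eta):\mathsf s(\gamma)=\mathsf t(\eta)\}$), multiplication $\mathsf m:\Sigma_2\to\Sigma$ and inverse $\mathrm{inv}$, together with a symplectic form $\omega$ on $\Sigma$ that is multiplicative, i.e. $\mathrm{pr}_1^*\omega-\mathsf m^*\omega+\mathrm{pr}_2^*\omega=0$ on $\Sigma_2$. Let $\mathcal P\subset T_{\mathbb C}\Sigma$ be a polarization of $\Sigma$, that is, a smooth complex subbundle which is * involutive; * Lagrangian for (the complexification of) $\omega$; * multiplicative: $T\mathsf m\big((\mathcal P\times\mathcal P)\cap T_{\mathbb C}\Sigma_2\big)_{(\gamma,\eta)}=\mathcal P_{\gamma\eta}$ for all $(\gamma,\eta)\in\Sigma_2$; * Hermitian: $T\mathrm{inv}(\mathcal P)=\overline{\mathcal P}$. Write $T^{\mathsf t}\Sigma=\ker T\mathsf t$, and define the (generally singular) real distributions $\mathcal D,\mathcal E\subseteq T\Sigma$ by $\mathcal D_{\mathbb C}=\mathcal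 P\cap\overline{\mathcal P}$ and $\mathcal E_{\mathbb C}=\mathcal P+\overline{\mathcal P}$. Suppose that $\operatorname{rk}(T^{\mathsf t}_{\mathbb C}\Sigma\cap\mathcal P)$ is constant. Then: 1. At every point of $\Sigma$, $\omega$ induces a well-defined nondegenerate bilinear form on $(T^{\mathsf t}\Sigma\cap\mathcal E)/(T^{\mathsf t}\Sigma\cap\mathcal D)$. 2. Hence, at every point of $\Sigma$, the dimension of $(T^{\mathsf t}\Sigma\cap\mathcal E)/(T^{\mathsf t}\Sigma\cap\mathcal D)$ is an even number $2k$, and for this $k\in\mathbb N$ contraction with $\frac{\omega^k}{k!}$ restricts to an isomorphism $$\Lambda^{\max}(T^{\mathsf t}\Sigma\cap\mathcal E)\;\xrightarrow{\ \sim\ }\;\Lambda^{\max}(T^{\mathsf t}\Sigma\cap\mathcal D).$$ 3. If moreover the rank of $(T^{\mathsf t}\Sigma\cap\mathcal E)/(T^{\mathsf t}\Sigma\cap\mathcal D)$ is constant on $\Sigma$, then there is a single $k\in\mathbb N$ such that at every point of $\Sigma$ that rank is $2k$ and contraction with $\frac{\omega^k}{k!}$ gives this isomorphism. Here contraction of multivectors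 in $\Lambda T\Sigma$ with forms is the one for which contraction with $\alpha\wedge\beta$ is contraction with $\beta$ followed by contraction with $\alpha$ (the opposite convention changes the map only by the sign $(-1)^k$). -/

import Mathlib

open scoped Manifold ContDiff TensorProduct

noncomputable section

namespace SympGpd

/-! ### Linear algebra: complexification -/

section Complexification

variable {V : Type*} [AddCommGroup V] [Module ℝ V]

/-- Complex conjugation on the complexification `ℂ ⊗ V` of a real vector space `V`. -/
def conj (V : Type*) [AddCommGroup V] [Module ℝ V] :
    (ℂ ⊗[ℝ] V) →ₛₗ[starRingEnd ℂ] (ℂ ⊗[ℝ] V) where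
  toFun := TensorProduct.map Complex.conjAe.toLinearMap (LinearMap.id : V →ₗ[ℝ] V)
  map_add' := map_add _
  map_smul' c z := by
    induction z using TensorProduct.induction_on with
    | zero => simp
    | tmul a v => simp [TensorProduct.smul_tmul']
    | add x y hx hy => rw [smul_add, map_add, hx, hy, map_add, smul_add]

/-- The vector `X + i Y` of `ℂ ⊗ V`. -/
def cvec (X Y : V) : ℂ ⊗[ℝ] V := (1 : ℂ) ⊗ₜ[ℝ] X + Complex.I ⊗ₜ[ℝ] Y

/-- The conjugate `P̄` of a complex subspace `P ⊆ ℂ ⊗ V`. -/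
def conjSubspace (P : Submodule ℂ (ℂ ⊗[ℝ] V)) : Submodule ℂ (ℂ ⊗[ℝ] V) :=
  P.map (conj V)

/-- The real vectors contained in a complex subspace `Q ⊆ ℂ ⊗ V`. If `Q` is invariant under
conjugation, then `Q` is the complexification of this real subspace. -/
def realPoints (Q : Submodule ℂ (ℂ ⊗[ℝ] V)) : Submodule ℝ V :=
  (Q.restrictScalars ℝ).comap (TensorProduct.mk ℝ ℂ V 1)

/-- The real subspace `D` of `V` with `D_ℂ = P ∩ P̄`. -/
def subD (P : Submodule ℂ (ℂ ⊗[ℝ] V)) : Submodule ℝ V := realPoints (P ⊓ conjSubspace P)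

/-- The real subspace `E` of `V` with `E_ℂ = P + P̄`. -/
def subE (P : Submodule ℂ (ℂ ⊗[ℝ] V)) : Submodule ℝ V := realPoints (P ⊔ conjSubspace P)

end Complexification

/-! ### Linear algebra: contraction of multivectors with exterior forms -/

section Contraction

variable {V : Type*} [AddCommGroup V] [Module ℝ V]

/-- The contraction of multivectors with exterior forms: the algebra homomorphism
`Λ(V*) → End(Λ V)` that sends a covector `α` to the interior product with `α`
(so that contraction with `α ∧ β` is contraction with `β` followed by contraction with `α`). -/
def contraction (V : Type*) [AddCommGroup V] [Module ℝ V] :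
    ExteriorAlgebra ℝ (Module.Dual ℝ V) →ₐ[ℝ] Module.End ℝ (ExteriorAlgebra ℝ V) :=
  ExteriorAlgebra.lift ℝ
    ⟨(CliffordAlgebra.contractLeft (Q := (0 : QuadraticForm ℝ V)) :
        Module.Dual ℝ V →ₗ[ℝ] Module.End ℝ (ExteriorAlgebra ℝ V)),
      fun d => LinearMap.ext fun x => CliffordAlgebra.contractLeft_contractLeft d x⟩

/-- An alternating bilinear form `B` on a finite-dimensional space, as an element of `Λ²(V*)`:
`½ ∑ᵢ eⁱ ∧ B(eᵢ, ·) = ∑_{i < j} B(eᵢ, eⱼ) eⁱ ∧ eʲ` for any basis `(eᵢ)` of `V`. -/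
def twoForm [FiniteDimensional ℝ V] (B : LinearMap.BilinForm ℝ V) :
    ExteriorAlgebra ℝ (Module.Dual ℝ V) :=
  (1 / 2 : ℝ) •
    (LinearMap.mul' ℝ (ExteriorAlgebra ℝ (Module.Dual ℝ V)))
      (TensorProduct.map (ExteriorAlgebra.ι ℝ) (ExteriorAlgebra.ι ℝ)
        ((dualTensorHomEquiv ℝ V (Module.Dual ℝ V)).symm B))

/-- Contraction with `Bᵏ / k!`, as an operator on `Λ V`. -/
def contractPow [FiniteDimensional ℝ V] (B : LinearMap.BilinForm ℝ V) (k : ℕ) :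
    ExteriorAlgebra ℝ V →ₗ[ℝ] ExteriorAlgebra ℝ V :=
  contraction V (((k.factorial : ℝ)⁻¹) • twoForm B ^ k)

/-- The top exterior power of a subspace `W ⊆ V`, as a line in `Λ V`. -/
def topExterior (W : Submodule ℝ V) : Submodule ℝ (ExteriorAlgebra ℝ V) :=
  Submodule.map (ExteriorAlgebra.map W.subtype).toLinearMap
    (⋀[ℝ]^(Module.finrank ℝ W) W)

/-- Contraction with `Bᵏ / k!` restricts to an isomorphism `Λ^max W → Λ^max W'`. -/
def ContractionIso [FiniteDimensional ℝ V] (B : LinearMap.BilinForm ℝ V) (k : ℕ)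
    (W W' : Submodule ℝ V) : Prop :=
  ∃ e : topExterior W ≃ₗ[ℝ] topExterior W',
    ∀ x : topExterior W,
      (e x : ExteriorAlgebra ℝ V) = contractPow B k (x : ExteriorAlgebra ℝ V)

/-- The bilinear form `B` descends to a well-defined, nondegenerate bilinear form on `W / W'`. -/
def NondegenerateOnQuotient (B : LinearMap.BilinForm ℝ V) (W W' : Submodule ℝ V) : Prop :=
  ∃ β : LinearMap.BilinForm ℝ (W ⧸ W'.submoduleOf W),
    (∀ X Y : W, β (Submodule.Quotient.mk X) (Submodule.Quotient.mk Y) = B X Y) ∧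
      β.Nondegenerate

end Contraction

/-! ### Vector fields and distributions on a manifold -/

section Manifolds

variable {EG : Type*} [NormedAddCommGroup EG] [NormedSpace ℝ EG]
  {G : Type*} [TopologicalSpace G] [ChartedSpace EG G]
  {EM : Type*} [NormedAddCommGroup EM] [NormedSpace ℝ EM]
  {M : Type*} [TopologicalSpace M] [ChartedSpace EM M]

/-- The identification of the tangent space at a point with the model space (by the preferred
chart at that point). It serves to compare tangent vectors at points that are equal, but not
syntactically so. -/
def toModel (g : G) : TangentSpace 𝓘(ℝ, EG) g ≃ₗ[ℝ] EG :=
  LinearEquiv.refl ℝ EG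

/-- The complexified derivative `T_ℂ f` at `g`. -/
def cderiv (f : G → M) (g : G) :
    (ℂ ⊗[ℝ] TangentSpace 𝓘(ℝ, EG) g) →ₗ[ℂ] (ℂ ⊗[ℝ] TangentSpace 𝓘(ℝ, EM) (f g)) :=
  (mfderiv 𝓘(ℝ, EG) 𝓘(ℝ, EM) f g).toLinearMap.baseChange ℂ

instance [FiniteDimensional ℝ EG] (g : G) :
    FiniteDimensional ℝ (TangentSpace 𝓘(ℝ, EG) g) :=
  inferInstanceAs (FiniteDimensional ℝ EG)

variable [IsManifold 𝓘(ℝ, EG) ∞ G]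

/-- `X` is a smooth vector field on the set `U`. -/
def SmoothVF (X : ∀ g : G, TangentSpace 𝓘(ℝ, EG) g) (U : Set G) : Prop :=
  ContMDiffOn 𝓘(ℝ, EG) 𝓘(ℝ, EG).tangent ∞
    (fun g => (⟨g, X g⟩ : TangentBundle 𝓘(ℝ, EG) G)) U

/-- The derivative at `g` of the real function `f` along the vector field `X`. -/
def lieDeriv (X : ∀ g : G, TangentSpace 𝓘(ℝ, EG) g) (f : G → ℝ) (g : G) : ℝ :=
  toModel (f g) (mfderiv 𝓘(ℝ, EG) 𝓘(ℝ, ℝ) f g (X g))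

/-- `P` is a (smooth, complex) distribution, that is a smooth subbundle of `T_ℂ G`: it has local
frames of smooth complex vector fields `X i + √-1 Y i`. -/
def IsDistribution (P : ∀ g : G, Submodule ℂ (ℂ ⊗[ℝ] TangentSpace 𝓘(ℝ, EG) g)) : Prop :=
  ∀ g₀ : G, ∃ U : Set G, IsOpen U ∧ g₀ ∈ U ∧
    ∃ (r : ℕ) (X Y : Fin r → ∀ g : G, TangentSpace 𝓘(ℝ, EG) g),
      (∀ i, SmoothVF (X i) U ∧ SmoothVF (Y i) U) ∧
      ∀ g ∈ U, LinearIndependent ℂ (fun i => cvec (X i g) (Y i g)) ∧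
        Submodule.span ℂ (Set.range fun i => cvec (X i g) (Y i g)) = P g

/-- `P` is involutive: the Lie bracket of two smooth (local, complex) sections
`X + √-1 Y` and `X' + √-1 Y'` of `P` is a section of `P`. -/
def IsInvolutive (P : ∀ g : G, Submodule ℂ (ℂ ⊗[ℝ] TangentSpace 𝓘(ℝ, EG) g)) : Prop :=
  ∀ (U : Set G) (X Y X' Y' : ∀ g : G, TangentSpace 𝓘(ℝ, EG) g), IsOpen U →
    SmoothVF X U → SmoothVF Y U → SmoothVF X' U → SmoothVF Y' U →
    (∀ g ∈ U, cvec (X g) (Y g) ∈ P g) → (∀ g ∈ U, cvec (X' g) (Y' g) ∈ P g) →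
    ∀ g ∈ U,
      cvec
        (VectorField.mlieBracket 𝓘(ℝ, EG) X X' g - VectorField.mlieBracket 𝓘(ℝ, EG) Y Y' g)
        (VectorField.mlieBracket 𝓘(ℝ, EG) X Y' g + VectorField.mlieBracket 𝓘(ℝ, EG) Y X' g)
        ∈ P g

/-- A symplectic form on `G`: a smooth, closed, nondegenerate 2-form. Closedness is expressed by
the invariant formula for `(dω)(X, Y, Z)`. -/
structure SymplecticForm (EG : Type*) [NormedAddCommGroup EG] [NormedSpace ℝ EG]
    (G : Type*) [TopologicalSpace G] [ChartedSpace EG G] [IsManifold 𝓘(ℝ, EG) ∞ G] where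
  /-- The value of the form at a point. -/
  form : ∀ g : G, TangentSpace 𝓘(ℝ, EG) g →L[ℝ] TangentSpace 𝓘(ℝ, EG) g →L[ℝ] ℝ
  smooth : ContMDiff 𝓘(ℝ, EG) (𝓘(ℝ, EG).prod 𝓘(ℝ, EG →L[ℝ] EG →L[ℝ] ℝ)) ∞
    (fun g => Bundle.TotalSpace.mk' (EG →L[ℝ] EG →L[ℝ] ℝ)
      (E := fun g : G => TangentSpace 𝓘(ℝ, EG) g →L[ℝ] TangentSpace 𝓘(ℝ, EG) g →L[ℝ] ℝ)
      g (form g))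
  alternating : ∀ (g : G) (X : TangentSpace 𝓘(ℝ, EG) g), form g X X = 0
  nondegenerate : ∀ (g : G) (X : TangentSpace 𝓘(ℝ, EG) g), (∀ Y, form g X Y = 0) → X = 0
  closed : ∀ (U : Set G) (X Y Z : ∀ g : G, TangentSpace 𝓘(ℝ, EG) g), IsOpen U →
    SmoothVF X U → SmoothVF Y U → SmoothVF Z U → ∀ g ∈ U,
      lieDeriv X (fun h => form h (Y h) (Z h)) g
        + lieDeriv Y (fun h => form h (Z h) (X h)) g
        + lieDeriv Z (fun h => form h (X h) (Y h)) g
        - form g (VectorField.mlieBracket 𝓘(ℝ, EG) X Y g) (Z g)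
        - form g (VectorField.mlieBracket 𝓘(ℝ, EG) Y Z g) (X g)
        - form g (VectorField.mlieBracket 𝓘(ℝ, EG) Z X g) (Y g) = 0

end Manifolds

/-! ### Lie groupoids and symplectic groupoids -/

/-- A Lie groupoid `G` over `M`. The product `mul γ η` is meaningful for the composable pairs,
those with `s γ = t η`; its values at other pairs are irrelevant. -/
structure LieGroupoid (EG : Type*) [NormedAddCommGroup EG] [NormedSpace ℝ EG]
    (EM : Type*) [NormedAddCommGroup EM] [NormedSpace ℝ EM]
    (G : Type*) [TopologicalSpace G] [ChartedSpace EG G]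
    (M : Type*) [TopologicalSpace M] [ChartedSpace EM M] where
  /-- The source map. -/
  s : G → M
  /-- The target map. -/
  t : G → M
  /-- The inclusion of the units. -/
  unit : M → G
  /-- The inverse. -/
  inv : G → G
  /-- The multiplication. -/
  mul : G → G → G
  s_unit : ∀ x, s (unit x) = x
  t_unit : ∀ x, t (unit x) = x
  s_mul : ∀ γ η, s γ = t η → s (mul γ η) = s η
  t_mul : ∀ γ η, s γ = t η → t (mul γ η) = t γ
  mul_assoc : ∀ γ η ζ, s γ = t η → s η = t ζ → mul (mul γ η) ζ = mul γ (mul η ζ)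
  unit_mul : ∀ γ, mul (unit (t γ)) γ = γ
  mul_unit : ∀ γ, mul γ (unit (s γ)) = γ
  s_inv : ∀ γ, s (inv γ) = t γ
  t_inv : ∀ γ, t (inv γ) = s γ
  mul_inv : ∀ γ, mul γ (inv γ) = unit (t γ)
  inv_mul : ∀ γ, mul (inv γ) γ = unit (s γ)
  submersion_s : Manifold.IsSubmersion 𝓘(ℝ, EG) 𝓘(ℝ, EM) ∞ s
  submersion_t : Manifold.IsSubmersion 𝓘(ℝ, EG) 𝓘(ℝ, EM) ∞ t
  smooth_unit : ContMDiff 𝓘(ℝ, EM) 𝓘(ℝ, EG) ∞ unit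
  smooth_inv : ContMDiff 𝓘(ℝ, EG) 𝓘(ℝ, EG) ∞ inv
  smooth_mul : ContMDiffOn (𝓘(ℝ, EG).prod 𝓘(ℝ, EG)) 𝓘(ℝ, EG) ∞
    (Function.uncurry mul) {p : G × G | s p.1 = t p.2}

namespace LieGroupoid

variable {EG : Type*} [NormedAddCommGroup EG] [NormedSpace ℝ EG]
  {EM : Type*} [NormedAddCommGroup EM] [NormedSpace ℝ EM]
  {G : Type*} [TopologicalSpace G] [ChartedSpace EG G]
  {M : Type*} [TopologicalSpace M] [ChartedSpace EM M]
  (𝒢 : LieGroupoid EG EM G M)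

/-- The manifold `G₂` of composable pairs. -/
def nerve₂ : Set (G × G) := {p | 𝒢.s p.1 = 𝒢.t p.2}

/-- The derivative of the source map, with values in the model space of `M`. -/
def ds (γ : G) : TangentSpace 𝓘(ℝ, EG) γ →ₗ[ℝ] EM :=
  (toModel (𝒢.s γ)).toLinearMap ∘ₗ (mfderiv 𝓘(ℝ, EG) 𝓘(ℝ, EM) 𝒢.s γ).toLinearMap

/-- The derivative of the target map, with values in the model space of `M`. -/
def dt (γ : G) : TangentSpace 𝓘(ℝ, EG) γ →ₗ[ℝ] EM :=
  (toModel (𝒢.t γ)).toLinearMap ∘ₗ (mfderiv 𝓘(ℝ, EG) 𝓘(ℝ, EM) 𝒢.t γ).toLinearMap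

/-- The derivative of the multiplication at a composable pair `(γ, η)`. Only its values at the
vectors `(X, Y)` tangent to `G₂`, those with `Ts X = Tt Y`, are meaningful. -/
def dmul (γ η : G) :
    (TangentSpace 𝓘(ℝ, EG) γ × TangentSpace 𝓘(ℝ, EG) η) →ₗ[ℝ]
      TangentSpace 𝓘(ℝ, EG) (𝒢.mul γ η) :=
  ((mfderivWithin (𝓘(ℝ, EG).prod 𝓘(ℝ, EG)) 𝓘(ℝ, EG) (Function.uncurry 𝒢.mul)
      𝒢.nerve₂ (γ, η)).toLinearMap : (EG × EG) →ₗ[ℝ] EG)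

/-- The complexification of `dmul`. -/
def cdmul (γ η : G) (Z : ℂ ⊗[ℝ] TangentSpace 𝓘(ℝ, EG) γ)
    (W : ℂ ⊗[ℝ] TangentSpace 𝓘(ℝ, EG) η) : ℂ ⊗[ℝ] TangentSpace 𝓘(ℝ, EG) (𝒢.mul γ η) :=
  (𝒢.dmul γ η ∘ₗ LinearMap.inl ℝ _ _).baseChange ℂ Z
    + (𝒢.dmul γ η ∘ₗ LinearMap.inr ℝ _ _).baseChange ℂ W

/-- `Tᵗ G = ker Tt`. -/
def Tt (γ : G) : Submodule ℝ (TangentSpace 𝓘(ℝ, EG) γ) := LinearMap.ker (𝒢.dt γ)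

/-- `Tᵗ_ℂ G`, the kernel of the complexified derivative of the target map. -/
def TtC (γ : G) : Submodule ℂ (ℂ ⊗[ℝ] TangentSpace 𝓘(ℝ, EG) γ) :=
  LinearMap.ker ((𝒢.dt γ).baseChange ℂ)

/-- `P` is multiplicative: `Tm(P₂) = P` at each composable pair `(γ, η)`, where
`P₂ = (P × P) ∩ T_ℂ G₂`. -/
def IsMultiplicative (P : ∀ g : G, Submodule ℂ (ℂ ⊗[ℝ] TangentSpace 𝓘(ℝ, EG) g)) : Prop :=
  ∀ γ η : G, 𝒢.s γ = 𝒢.t η → ∀ V : ℂ ⊗[ℝ] TangentSpace 𝓘(ℝ, EG) (𝒢.mul γ η),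
    V ∈ P (𝒢.mul γ η) ↔
      ∃ Z ∈ P γ, ∃ W ∈ P η,
        (𝒢.ds γ).baseChange ℂ Z = (𝒢.dt η).baseChange ℂ W ∧ 𝒢.cdmul γ η Z W = V

/-- `P` is Hermitian: `T inv (P) = P̄`. -/
def IsHermitian (P : ∀ g : G, Submodule ℂ (ℂ ⊗[ℝ] TangentSpace 𝓘(ℝ, EG) g)) : Prop :=
  ∀ γ : G, (P γ).map (cderiv 𝒢.inv γ) = conjSubspace (P (𝒢.inv γ))

end LieGroupoid

/-- A symplectic groupoid: a Lie groupoid with a multiplicative symplectic form,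
`pr₁^* ω - m^* ω + pr₂^* ω = 0` on `G₂`. -/
structure SymplecticGroupoid (EG : Type*) [NormedAddCommGroup EG] [NormedSpace ℝ EG]
    (EM : Type*) [NormedAddCommGroup EM] [NormedSpace ℝ EM]
    (G : Type*) [TopologicalSpace G] [ChartedSpace EG G] [IsManifold 𝓘(ℝ, EG) ∞ G]
    (M : Type*) [TopologicalSpace M] [ChartedSpace EM M]
    extends LieGroupoid EG EM G M where
  /-- The symplectic form. -/
  symp : SymplecticForm EG G
  multiplicative : ∀ γ η : G, s γ = t η →
    ∀ (X X' : TangentSpace 𝓘(ℝ, EG) γ) (Y Y' : TangentSpace 𝓘(ℝ, EG) η),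
      toLieGroupoid.ds γ X = toLieGroupoid.dt η Y →
      toLieGroupoid.ds γ X' = toLieGroupoid.dt η Y' →
      symp.form γ X X' - symp.form (mul γ η) (toLieGroupoid.dmul γ η (X, Y))
        (toLieGroupoid.dmul γ η (X', Y')) + symp.form η Y Y' = 0

namespace SymplecticGroupoid

variable {EG : Type*} [NormedAddCommGroup EG] [NormedSpace ℝ EG]
  {EM : Type*} [NormedAddCommGroup EM] [NormedSpace ℝ EM]
  {G : Type*} [TopologicalSpace G] [ChartedSpace EG G] [IsManifold 𝓘(ℝ, EG) ∞ G]
  {M : Type*} [TopologicalSpace M] [ChartedSpace EM M]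
  (S : SymplecticGroupoid EG EM G M)

/-- The symplectic form at `g` as a bilinear form. -/
def bilin (g : G) : LinearMap.BilinForm ℝ (TangentSpace 𝓘(ℝ, EG) g) :=
  (S.symp.form g).toLinearMap₁₂

/-- `P` is Lagrangian: `P` equals its orthogonal with respect to the complexification of `ω`. -/
def IsLagrangian (P : ∀ g : G, Submodule ℂ (ℂ ⊗[ℝ] TangentSpace 𝓘(ℝ, EG) g)) : Prop :=
  ∀ (g : G) (Z : ℂ ⊗[ℝ] TangentSpace 𝓘(ℝ, EG) g),
    Z ∈ P g ↔ ∀ W ∈ P g, (S.bilin g).baseChange ℂ Z W = 0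

/-- A polarization of a symplectic groupoid: an involutive, multiplicative, Hermitian, Lagrangian
distribution. -/
structure IsPolarization
    (P : ∀ g : G, Submodule ℂ (ℂ ⊗[ℝ] TangentSpace 𝓘(ℝ, EG) g)) : Prop where
  distribution : IsDistribution P
  involutive : IsInvolutive P
  multiplicative : S.toLieGroupoid.IsMultiplicative P
  hermitian : S.toLieGroupoid.IsHermitian P
  lagrangian : S.IsLagrangian P

/-- The real vector space `Tᵗ Σ ∩ D` at `g`, where `D_ℂ = P ∩ P̄`. -/
def TtD (P : ∀ g : G, Submodule ℂ (ℂ ⊗[ℝ] TangentSpace 𝓘(ℝ, EG) g)) (g : G) :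
    Submodule ℝ (TangentSpace 𝓘(ℝ, EG) g) :=
  S.toLieGroupoid.Tt g ⊓ subD (P g)

/-- The real vector space `Tᵗ Σ ∩ E` at `g`, where `E_ℂ = P + P̄`. -/
def TtE (P : ∀ g : G, Submodule ℂ (ℂ ⊗[ℝ] TangentSpace 𝓘(ℝ, EG) g)) (g : G) :
    Submodule ℝ (TangentSpace 𝓘(ℝ, EG) g) :=
  S.toLieGroupoid.Tt g ⊓ subE (P g)

end SymplecticGroupoid

end SympGpd

end

/-! Everything rests on one pointwise fact, `IsPolarization.orthogonal_iff_mem_TtD`: the radical of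
ω on Tᵗ ∩ E is Tᵗ ∩ D. The rest is linear algebra of an alternating form. Hyperbolic planes are
split off until only the radical remains (`exists_hyperbolic_complement`), and each contraction with
ω removes one plane from a top multivector (`contraction_twoForm_pow_pair`,
`exists_topExterior_contraction_pow`).

That D is orthogonal to E is the isotropy of P and P̄. For the converse, a Lagrangian P has half the
dimension, so constancy of the rank of Tᵗ ∩ P fixes the rank of Tt(P). Multiplicativity gives Tt(P)
at γγ⁻¹ inside Tt(P) at γ, so Tt(P_γ) depends only on t(γ) (`map_cT_eq`); call it P₀. As P is
Hermitian, Ts(P_γ) contains the conjugate of P₀ at s(γ) (`exists_cS_eq`). Two consequences follow.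

First, a vector of P₀ ∩ P̄₀, seen as tangent to the units, lies in P; factoring it over γγ⁻¹ lifts
it to P ∩ P̄ at γ (`cU_mem`, `exists_real_lift`). Correcting by such lifts splits Tᵗ ∩ (P + P̄) into
Tᵗ ∩ P and Tᵗ ∩ P̄ (`exists_decomposition`).

Second, a vector a of Tᵗ ∩ P orthogonal to Tᵗ ∩ P̄ lies in P̄ (`conj_mem`). Indeed, for W in P, the
vector W̄ is a sum of vectors of Tᵗ ∩ P̄, of ker Ts and of P, all orthogonal to a; for ker Ts this
is the orthogonality of source and target fibres (`om_eq_zero`). Applied to both halves of a vector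
in the radical, this puts it in P ∩ P̄. -/

noncomputable section

open scoped Topology

namespace SympGpd

/-! ### Contraction of multivectors with a two-form. -/

section ContractionLemmas

variable {V : Type*} [AddCommGroup V] [Module ℝ V]

/-- The interiorProd product with a covector, as an operator on `Λ V`. -/
abbrev interiorProd (d : Module.Dual ℝ V) : Module.End ℝ (ExteriorAlgebra ℝ V) :=
  CliffordAlgebra.contractLeft (Q := (0 : QuadraticForm ℝ V)) d

lemma interiorProd_ι_mul (d : Module.Dual ℝ V) (v : V) (x : ExteriorAlgebra ℝ V) :
    interiorProd d (ExteriorAlgebra.ι ℝ v * x) = d v • x - ExteriorAlgebra.ι ℝ v * interiorProd d x :=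
  CliffordAlgebra.contractLeft_ι_mul _ _ _

lemma interiorProd_comm (d d' : Module.Dual ℝ V) (x : ExteriorAlgebra ℝ V) :
    interiorProd d (interiorProd d' x) = -interiorProd d' (interiorProd d x) :=
  CliffordAlgebra.contractLeft_comm _ _ _

lemma interiorProd_neg (d : Module.Dual ℝ V) (x : ExteriorAlgebra ℝ V) :
    interiorProd (-d) x = -interiorProd d x := by
  simp [interiorProd]

lemma interiorProd_algebraMap (d : Module.Dual ℝ V) (r : ℝ) :
    interiorProd d (algebraMap ℝ (ExteriorAlgebra ℝ V) r) = 0 :=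
  CliffordAlgebra.contractLeft_algebraMap _ _ _

lemma interiorProd_map_eq_zero {W : Submodule ℝ V} {d : Module.Dual ℝ V}
    (hd : ∀ w ∈ W, d w = 0) (z : ExteriorAlgebra ℝ W) :
    interiorProd d (ExteriorAlgebra.map W.subtype z) = 0 := by
  induction z using CliffordAlgebra.left_induction with
  | algebraMap r => rw [AlgHom.commutes, interiorProd_algebraMap]
  | add x y hx hy => rw [map_add, map_add, hx, hy, add_zero]
  | ι_mul x m hx =>
    change interiorProd d (ExteriorAlgebra.map W.subtype (ExteriorAlgebra.ι ℝ m * x)) = 0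
    rw [map_mul, ExteriorAlgebra.map_apply_ι, interiorProd_ι_mul, hx, Submodule.subtype_apply,
      hd _ m.2]
    simp

lemma contraction_ι (d : Module.Dual ℝ V) :
    contraction V (ExteriorAlgebra.ι ℝ d) = interiorProd d := by
  simp [contraction, interiorProd]

/-- The element `∑ αᵢ ∧ βᵢ` of `Λ²(V*)` determined by a tensor `∑ αᵢ ⊗ βᵢ`. -/
def wedgeTensor (V : Type*) [AddCommGroup V] [Module ℝ V] :
    Module.Dual ℝ V ⊗[ℝ] Module.Dual ℝ V →ₗ[ℝ] ExteriorAlgebra ℝ (Module.Dual ℝ V) :=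
  LinearMap.mul' ℝ (ExteriorAlgebra ℝ (Module.Dual ℝ V)) ∘ₗ
    TensorProduct.map (ExteriorAlgebra.ι ℝ) (ExteriorAlgebra.ι ℝ)

lemma contraction_wedgeTensor_tmul (a b : Module.Dual ℝ V) (x : ExteriorAlgebra ℝ V) :
    contraction V (wedgeTensor V (a ⊗ₜ b)) x = interiorProd a (interiorProd b x) := by
  simp [wedgeTensor, contraction_ι]

/-- Moving contraction with a ∧ b past v ∧ costs b(v) i_a − a(v) i_b; these are the tensor, flipped
and unflipped, evaluated at v. -/
lemma contraction_wedgeTensor_ι_mul (T : Module.Dual ℝ V ⊗[ℝ] Module.Dual ℝ V) (v : V)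
    (x : ExteriorAlgebra ℝ V) :
    contraction V (wedgeTensor V T) (ExteriorAlgebra.ι ℝ v * x) =
      ExteriorAlgebra.ι ℝ v * contraction V (wedgeTensor V T) x
        + interiorProd ((dualTensorHom ℝ V (Module.Dual ℝ V) T).flip v) x
        - interiorProd (dualTensorHom ℝ V (Module.Dual ℝ V) T v) x := by
  induction T using TensorProduct.induction_on with
  | zero =>
    have h0 : LinearMap.flip (0 : V →ₗ[ℝ] Module.Dual ℝ V) v = 0 := rfl
    simp [h0]
  | tmul a b =>
    have h1 : (dualTensorHom ℝ V (Module.Dual ℝ V) (a ⊗ₜ b)).flip v = b v • a := by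
      ext w; simp [mul_comm]
    have h2 : dualTensorHom ℝ V (Module.Dual ℝ V) (a ⊗ₜ b) v = a v • b := by
      ext w; simp
    rw [h1, h2]
    simp only [contraction_wedgeTensor_tmul, interiorProd_ι_mul, map_sub, map_smul,
      LinearMap.smul_apply]
    abel
  | add T T' h h' =>
    have hf : (dualTensorHom ℝ V (Module.Dual ℝ V) (T + T')).flip v =
        (dualTensorHom ℝ V (Module.Dual ℝ V) T).flip v
          + (dualTensorHom ℝ V (Module.Dual ℝ V) T').flip v := by
      ext w; simp
    rw [hf]
    simp only [map_add, LinearMap.add_apply, h, h', mul_add]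
    abel

lemma contraction_wedgeTensor_interiorProd (T : Module.Dual ℝ V ⊗[ℝ] Module.Dual ℝ V)
    (d : Module.Dual ℝ V) (x : ExteriorAlgebra ℝ V) :
    contraction V (wedgeTensor V T) (interiorProd d x) =
      interiorProd d (contraction V (wedgeTensor V T) x) := by
  induction T using TensorProduct.induction_on with
  | zero => simp
  | tmul a b =>
    simp only [contraction_wedgeTensor_tmul]
    rw [interiorProd_comm b d, map_neg, interiorProd_comm a d, neg_neg]
  | add T T' h h' => simp only [map_add, LinearMap.add_apply, h, h']

variable [FiniteDimensional ℝ V] {B : LinearMap.BilinForm ℝ V}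

lemma contraction_twoForm (B : LinearMap.BilinForm ℝ V) (x : ExteriorAlgebra ℝ V) :
    contraction V (twoForm B) x =
      (1 / 2 : ℝ) • contraction V
        (wedgeTensor V ((dualTensorHomEquiv ℝ V (Module.Dual ℝ V)).symm B)) x := by
  rw [twoForm, map_smul]; rfl

/-- Skew-symmetry makes the two correction terms equal, and the factor ½ in `twoForm` merges them
into one. -/
lemma contraction_twoForm_ι_mul (hB : B.IsAlt) (v : V) (x : ExteriorAlgebra ℝ V) :
    contraction V (twoForm B) (ExteriorAlgebra.ι ℝ v * x) =
      ExteriorAlgebra.ι ℝ v * contraction V (twoForm B) x - interiorProd (B v) x := by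
  have hd : dualTensorHom ℝ V (Module.Dual ℝ V)
      ((dualTensorHomEquiv ℝ V (Module.Dual ℝ V)).symm B) = B :=
    (dualTensorHomEquiv ℝ V (Module.Dual ℝ V)).apply_symm_apply B
  have hf : LinearMap.flip B v = -B v := by
    ext w; simpa using (hB.neg_eq v w).symm
  rw [contraction_twoForm, contraction_wedgeTensor_ι_mul, hd, hf, contraction_twoForm, interiorProd_neg,
    mul_smul_comm]
  module

lemma contraction_twoForm_interiorProd (B : LinearMap.BilinForm ℝ V) (d : Module.Dual ℝ V)
    (x : ExteriorAlgebra ℝ V) :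
    contraction V (twoForm B) (interiorProd d x) = interiorProd d (contraction V (twoForm B) x) := by
  rw [contraction_twoForm, contraction_twoForm, contraction_wedgeTensor_interiorProd, map_smul]

/-- The conditions on `y` hold for multivectors of the orthogonal complement of e and f. The form is
then either spent on the plane, leaving −y, or acts on y alone. -/
lemma contraction_twoForm_pair (hB : B.IsAlt) {e f : V} (hef : B e f = 1)
    {y : ExteriorAlgebra ℝ V} (he : interiorProd (B e) y = 0) (hf : interiorProd (B f) y = 0) :
    contraction V (twoForm B) (ExteriorAlgebra.ι ℝ e * (ExteriorAlgebra.ι ℝ f * y)) =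
      ExteriorAlgebra.ι ℝ e * (ExteriorAlgebra.ι ℝ f * contraction V (twoForm B) y) - y := by
  rw [contraction_twoForm_ι_mul hB, contraction_twoForm_ι_mul hB, interiorProd_ι_mul, he, hf, hef]
  simp

/-- A Leibniz rule: at most one of the k + 1 contractions can be spent on the plane e ∧ f, and there
are k + 1 choices for it. -/
lemma contraction_twoForm_pow_pair (hB : B.IsAlt) {e f : V} (hef : B e f = 1)
    {y : ExteriorAlgebra ℝ V} (he : interiorProd (B e) y = 0) (hf : interiorProd (B f) y = 0) (k : ℕ) :
    (contraction V (twoForm B) ^ (k + 1))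
        (ExteriorAlgebra.ι ℝ e * (ExteriorAlgebra.ι ℝ f * y)) =
      ExteriorAlgebra.ι ℝ e * (ExteriorAlgebra.ι ℝ f *
        (contraction V (twoForm B) ^ (k + 1)) y)
        - ((k : ℝ) + 1) • (contraction V (twoForm B) ^ k) y := by
  induction k generalizing y with
  | zero => simp [contraction_twoForm_pair hB hef he hf]
  | succ k ih =>
    -- The induction hypothesis is used for the contraction of y, which is still killed by both
    -- interior products because they commute with the contraction.
    rw [pow_succ _ (k + 1), Module.End.mul_apply, contraction_twoForm_pair hB hef he hf, map_sub,
      ih (by rw [← contraction_twoForm_interiorProd, he, map_zero])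
        (by rw [← contraction_twoForm_interiorProd, hf, map_zero])]
    simp only [pow_succ, Module.End.mul_apply, Nat.cast_add, Nat.cast_one]
    module

lemma contraction_twoForm_algebraMap (B : LinearMap.BilinForm ℝ V) (r : ℝ) :
    contraction V (twoForm B) (algebraMap ℝ (ExteriorAlgebra ℝ V) r) = 0 := by
  rw [contraction_twoForm]
  generalize (dualTensorHomEquiv ℝ V (Module.Dual ℝ V)).symm B = T
  induction T using TensorProduct.induction_on with
  | zero => simp
  | tmul a b => rw [contraction_wedgeTensor_tmul, interiorProd_algebraMap, map_zero, smul_zero]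
  | add T T' h h' => rw [map_add, map_add, LinearMap.add_apply, smul_add, h, h', add_zero]

/-- Moving past m costs the interior product with B m, which vanishes on Λ W because W is isotropic.
-/
lemma contraction_twoForm_map_eq_zero (hB : B.IsAlt) {W : Submodule ℝ V}
    (hW : ∀ v ∈ W, ∀ w ∈ W, B v w = 0) (z : ExteriorAlgebra ℝ W) :
    contraction V (twoForm B) (ExteriorAlgebra.map W.subtype z) = 0 := by
  induction z using CliffordAlgebra.left_induction with
  | algebraMap r => rw [AlgHom.commutes, contraction_twoForm_algebraMap]
  | add x y hx hy => rw [map_add, map_add, hx, hy, add_zero]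
  | ι_mul x m hx =>
    change contraction V (twoForm B)
      (ExteriorAlgebra.map W.subtype (ExteriorAlgebra.ι ℝ m * x)) = 0
    rw [map_mul, ExteriorAlgebra.map_apply_ι, contraction_twoForm_ι_mul hB, hx,
      Submodule.subtype_apply, interiorProd_map_eq_zero (hW m m.2), mul_zero, sub_zero]

end ContractionLemmas

/-! ### Top exterior powers and the radical of an alternating form. -/

section TopExterior

variable {V : Type*} [AddCommGroup V] [Module ℝ V]

lemma exists_map_eq_of_mem_topExterior {W : Submodule ℝ V} {x : ExteriorAlgebra ℝ V}
    (hx : x ∈ topExterior W) : ∃ z, ExteriorAlgebra.map W.subtype z = x := by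
  obtain ⟨z, -, hz⟩ := hx
  exact ⟨z, hz⟩

/-- Writing the line as a power of the image of W in Λ V makes products and inclusions of subspaces
available. -/
lemma topExterior_eq_pow (W : Submodule ℝ V) :
    topExterior W = (W.map (ExteriorAlgebra.ι ℝ)) ^ Module.finrank ℝ W := by
  have h : (LinearMap.range (ExteriorAlgebra.ι ℝ : W →ₗ[ℝ] ExteriorAlgebra ℝ W)).map
      (ExteriorAlgebra.map W.subtype).toLinearMap = W.map (ExteriorAlgebra.ι ℝ) := by
    rw [← LinearMap.range_comp, ExteriorAlgebra.map_comp_ι, LinearMap.range_comp,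
      Submodule.range_subtype]
  rw [topExterior, Submodule.map_pow, h]

lemma mul_mem_topExterior {W W₁ : Submodule ℝ V} (hle : W₁ ≤ W)
    (hdim : Module.finrank ℝ W = Module.finrank ℝ W₁ + 2) {e f : V} (he : e ∈ W) (hf : f ∈ W)
    {y : ExteriorAlgebra ℝ V} (hy : y ∈ topExterior W₁) :
    ExteriorAlgebra.ι ℝ e * (ExteriorAlgebra.ι ℝ f * y) ∈ topExterior W := by
  rw [topExterior_eq_pow] at hy ⊢
  rw [hdim, pow_succ', pow_succ']
  exact Submodule.mul_mem_mul (Submodule.mem_map_of_mem he)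
    (Submodule.mul_mem_mul (Submodule.mem_map_of_mem hf)
      (pow_le_pow_left' (Submodule.map_mono hle) _ hy))

/-- The hypothesis identifies W' ∩ W with the radical of B on W, so B is lifted to the quotient one
slot at a time; skew-symmetry serves the second slot. -/
lemma nondegenerateOnQuotient {B : LinearMap.BilinForm ℝ V} (hB : B.IsAlt)
    {W W' : Submodule ℝ V} (hrad : ∀ x ∈ W, (∀ y ∈ W, B x y = 0) ↔ x ∈ W') :
    NondegenerateOnQuotient B W W' := by
  have hswap : ∀ x y, B x y = -B y x := fun x y => (hB.neg_eq y x).symm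
  have h0 : ∀ x : W, x ∈ W'.submoduleOf W ↔ ∀ y : W, B x y = 0 := fun x =>
    ⟨fun h y => (hrad x x.2).2 h y y.2, fun h => (hrad x x.2).1 fun y hy => h ⟨y, hy⟩⟩
  let β₁ : W → (W ⧸ W'.submoduleOf W) →ₗ[ℝ] ℝ := fun x =>
    (W'.submoduleOf W).liftQ ((B x).domRestrict W) fun y hy => by
      simpa [hswap x y] using (h0 y).1 hy x
  let β₂ : W →ₗ[ℝ] (W ⧸ W'.submoduleOf W) →ₗ[ℝ] ℝ :=
    { toFun := β₁
      map_add' := fun x y => by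
        ext z; simp [β₁]
      map_smul' := fun c y => by
        ext z; simp [β₁] }
  let β : LinearMap.BilinForm ℝ (W ⧸ W'.submoduleOf W) :=
    (W'.submoduleOf W).liftQ β₂ fun x hx => by
      rw [LinearMap.mem_ker]
      ext z
      simpa [β₂, β₁] using (h0 x).1 hx z
  have hβ : ∀ X Y : W, β (Submodule.Quotient.mk X) (Submodule.Quotient.mk Y) = B X Y :=
    fun X Y => rfl
  refine ⟨β, hβ, ?_, ?_⟩
  · intro X hX
    obtain ⟨x, rfl⟩ := Submodule.Quotient.mk_surjective _ X
    exact (Submodule.Quotient.mk_eq_zero _).2 ((h0 x).2 fun y => by rw [← hβ]; exact hX _)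
  · intro X hX
    obtain ⟨x, rfl⟩ := Submodule.Quotient.mk_surjective _ X
    refine (Submodule.Quotient.mk_eq_zero _).2 ((h0 x).2 fun y => ?_)
    rw [hswap, ← hβ, hX, neg_zero]

variable [FiniteDimensional ℝ V]

lemma finrank_topExterior (W : Submodule ℝ V) : Module.finrank ℝ (topExterior W) = 1 := by
  have hinj : Function.Injective (ExteriorAlgebra.map W.subtype).toLinearMap :=
    ExteriorAlgebra.map_injective_field (Submodule.ker_subtype W)
  rw [topExterior, ← (Submodule.equivMapOfInjective _ hinj _).finrank_eq, exteriorPower.finrank_eq,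
    Nat.choose_self]

instance (W : Submodule ℝ V) : FiniteDimensional ℝ (topExterior W) :=
  Module.finite_of_finrank_pos (by rw [finrank_topExterior]; norm_num)

/-- A hyperbolic plane splits off an alternating form. -/
lemma exists_hyperbolic_complement {B : LinearMap.BilinForm ℝ V} (hB : B.IsAlt)
    {W W' : Submodule ℝ V} (hle : W' ≤ W)
    (hrad : ∀ x ∈ W, (∀ y ∈ W, B x y = 0) ↔ x ∈ W') (hne : W' ≠ W) :
    ∃ e ∈ W, ∃ f ∈ W, B e f = 1 ∧ ∃ W₁ : Submodule ℝ V, W' ≤ W₁ ∧ W₁ ≤ W ∧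
      Module.finrank ℝ W = Module.finrank ℝ W₁ + 2 ∧
      (∀ x ∈ W₁, B e x = 0 ∧ B f x = 0) ∧
      (∀ x ∈ W₁, (∀ y ∈ W₁, B x y = 0) ↔ x ∈ W') := by
  have hswap : ∀ x y, B x y = -B y x := fun x y => (hB.neg_eq y x).symm
  obtain ⟨e, heW, heW'⟩ := SetLike.exists_of_lt (lt_of_le_of_ne hle hne)
  have h1 : ¬ ∀ y ∈ W, B e y = 0 := fun h => heW' ((hrad e heW).1 h)
  push Not at h1
  obtain ⟨f₀, hf₀, hef₀⟩ := h1
  set f := (B e f₀)⁻¹ • f₀ with hf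
  have hfW : f ∈ W := W.smul_mem _ hf₀
  have hef : B e f = 1 := by simp [hf, hef₀]
  have hfe : B f e = -1 := by rw [hswap, hef]
  have hee : B e e = 0 := hB e
  have hff : B f f = 0 := hB f
  -- The complement W₁ is the kernel of pairing with e and f; surjectivity of this map gives
  -- codimension exactly 2.
  let φ : W →ₗ[ℝ] ℝ × ℝ := ((B e).prod (B f)).domRestrict W
  have hφ : Function.Surjective φ := by
    rintro ⟨a, b⟩
    refine ⟨⟨a • f - b • e, W.sub_mem (W.smul_mem _ hfW) (W.smul_mem _ heW)⟩, ?_⟩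
    simp [φ, hef, hfe, hee, hff]
  have hmem : ∀ x, x ∈ (LinearMap.ker φ).map W.subtype ↔ x ∈ W ∧ B e x = 0 ∧ B f x = 0 := by
    intro x
    simp only [Submodule.mem_map, LinearMap.mem_ker, φ]
    constructor
    · rintro ⟨y, hy, rfl⟩
      exact ⟨y.2, congrArg Prod.fst hy, congrArg Prod.snd hy⟩
    · rintro ⟨hx, h1, h2⟩
      exact ⟨⟨x, hx⟩, Prod.ext h1 h2, rfl⟩
  have hdim := LinearMap.finrank_range_add_finrank_ker φ
  rw [LinearMap.range_eq_top.2 hφ, finrank_top, Module.finrank_prod, Module.finrank_self] at hdim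
  have hle₁ : W' ≤ (LinearMap.ker φ).map W.subtype := by
    intro x hx
    have h := (hrad x (hle hx)).2 hx
    exact (hmem x).2 ⟨hle hx, by rw [hswap, h e heW, neg_zero], by rw [hswap, h f hfW, neg_zero]⟩
  refine ⟨e, heW, f, hfW, hef, (LinearMap.ker φ).map W.subtype, hle₁,
    fun x hx => ((hmem x).1 hx).1, ?_, fun x hx => ((hmem x).1 hx).2, ?_⟩
  · rw [← (Submodule.equivMapOfInjective W.subtype W.injective_subtype (LinearMap.ker φ)).finrank_eq]
    omega
  · intro x hx
    obtain ⟨hxW, hex, hfx⟩ := (hmem x).1 hx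
    refine ⟨fun h => (hrad x hxW).1 fun w hw => ?_,
      fun h y hy => (hrad x hxW).2 h y ((hmem y).1 hy).1⟩
    -- This is the projection of w to W₁ along the plane of e and f. Its pairing with x is that of
    -- w, since x is orthogonal to the plane.
    have hw₁ := h (w + B f w • e - B e w • f) ((hmem _).2
      ⟨W.sub_mem (W.add_mem hw (W.smul_mem _ heW)) (W.smul_mem _ hfW), by
        simp [hee, hef], by simp [hff, hfe]⟩)
    simpa [hswap x e, hex, hswap x f, hfx] using hw₁

/-- Induction on dim W, splitting off one hyperbolic plane. The vanishing of the next power is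
carried along since it kills the term e ∧ f ∧ (…) of the Leibniz rule; each plane then contributes a
factor −(k + 1). -/
lemma exists_topExterior_contraction_pow {B : LinearMap.BilinForm ℝ V} (hB : B.IsAlt)
    {W W' : Submodule ℝ V} (hle : W' ≤ W)
    (hrad : ∀ x ∈ W, (∀ y ∈ W, B x y = 0) ↔ x ∈ W') :
    ∃ k : ℕ, Module.finrank ℝ W = Module.finrank ℝ W' + 2 * k ∧
      ∃ x ∈ topExterior W, ∃ w ∈ topExterior W', w ≠ 0 ∧
        (contraction V (twoForm B) ^ k) x = ((-1) ^ k * (k.factorial : ℝ)) • w ∧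
        (contraction V (twoForm B) ^ (k + 1)) x = 0 := by
  induction hn : Module.finrank ℝ W using Nat.strong_induction_on generalizing W with
  | _ n ih =>
  by_cases hW : W' = W
  · subst hW
    obtain ⟨⟨w, hw⟩, hw0⟩ :=
      Module.finrank_pos_iff_exists_ne_zero.1 (by rw [finrank_topExterior W']; norm_num)
    refine ⟨0, by simpa using hn.symm, w, hw, w, hw, fun h => hw0 (Subtype.ext h), by simp, ?_⟩
    obtain ⟨z, rfl⟩ := exists_map_eq_of_mem_topExterior hw
    rw [zero_add, pow_one]
    exact contraction_twoForm_map_eq_zero hB (fun v hv => (hrad v hv).2 hv) z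
  · obtain ⟨e, he, f, hf, hef, W₁, hW'₁, hW₁, hdim, hperp, hrad₁⟩ :=
      exists_hyperbolic_complement hB hle hrad hW
    obtain ⟨k, hk, y, hy, w, hw, hw0, hky, hky'⟩ := ih _ (by omega) hW'₁ hrad₁ rfl
    have hint : ∀ d : Module.Dual ℝ V, (∀ v ∈ W₁, d v = 0) → interiorProd d y = 0 := by
      intro d hd
      obtain ⟨z, rfl⟩ := exists_map_eq_of_mem_topExterior hy
      exact interiorProd_map_eq_zero hd z
    have hpow := contraction_twoForm_pow_pair hB hef
      (hint (B e) fun v hv => (hperp v hv).1) (hint (B f) fun v hv => (hperp v hv).2)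
    refine ⟨k + 1, by omega, _, mul_mem_topExterior hW₁ hdim he hf hy, w, hw, hw0, ?_, ?_⟩
    · rw [hpow, hky', hky, Nat.factorial_succ]
      simp only [mul_zero, zero_sub, smul_smul, ← neg_smul]
      congr 1
      push_cast
      ring
    · rw [hpow, hky', pow_succ', Module.End.mul_apply, hky']
      simp

/-- Source and target are lines, so it suffices that one generator goes to a nonzero multiple of
another; the factor k! cancels and (−1)ᵏ remains. -/
theorem exists_contractionIso {B : LinearMap.BilinForm ℝ V} (hB : B.IsAlt)
    {W W' : Submodule ℝ V} (hle : W' ≤ W)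
    (hrad : ∀ x ∈ W, (∀ y ∈ W, B x y = 0) ↔ x ∈ W') :
    ∃ k : ℕ, Module.finrank ℝ W = Module.finrank ℝ W' + 2 * k ∧ ContractionIso B k W W' := by
  obtain ⟨k, hk, x, hx, w, hw, hw0, hkx, -⟩ := exists_topExterior_contraction_pow hB hle hrad
  refine ⟨k, hk, ?_⟩
  have hk0 : (k.factorial : ℝ) ≠ 0 := by exact_mod_cast k.factorial_ne_zero
  have hcx : contractPow B k x = (-1 : ℝ) ^ k • w := by
    rw [contractPow, map_smul, map_pow, LinearMap.smul_apply, hkx, smul_smul]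
    congr 1
    field_simp
  have hx0 : x ≠ 0 := by
    rintro rfl
    rw [map_zero] at hcx
    exact smul_ne_zero (pow_ne_zero k (by norm_num)) hw0 hcx.symm
  have hspan : ∀ y : topExterior W, ∃ c : ℝ, c • (⟨x, hx⟩ : topExterior W) = y :=
    (finrank_eq_one_iff_of_nonzero' _ fun h => hx0 (congrArg Subtype.val h)).1
      (finrank_topExterior W)
  have hmaps : ∀ y ∈ topExterior W, contractPow B k y ∈ topExterior W' := by
    intro y hy
    obtain ⟨c, hc⟩ := hspan ⟨y, hy⟩
    have hc' : c • x = y := congrArg Subtype.val hc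
    rw [← hc', map_smul, hcx]
    exact Submodule.smul_mem _ _ (Submodule.smul_mem _ _ hw)
  let F : topExterior W →ₗ[ℝ] topExterior W' := (contractPow B k).restrict hmaps
  have hFinj : Function.Injective F := by
    rw [← LinearMap.ker_eq_bot, LinearMap.ker_eq_bot']
    intro y hy
    obtain ⟨c, rfl⟩ := hspan y
    have h1 : contractPow B k (c • x) = 0 := congrArg Subtype.val hy
    rw [map_smul, hcx] at h1
    have hc : c = 0 := by
      by_contra hc
      exact smul_ne_zero hc (smul_ne_zero (pow_ne_zero k (by norm_num)) hw0) h1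
    rw [hc, zero_smul]
  exact ⟨LinearEquiv.ofInjectiveOfFinrankEq F hFinj
    (by rw [finrank_topExterior, finrank_topExterior]), fun y => rfl⟩

end TopExterior

/-! ### Submersions, local sections and lifting of curves. -/

section
variable {E : Type*} [NormedAddCommGroup E] [NormedSpace ℝ E]
  {N : Type*} [TopologicalSpace N] [ChartedSpace E N]
  {F : Type*} [NormedAddCommGroup F] [NormedSpace ℝ F]
  {M : Type*} [TopologicalSpace M] [ChartedSpace F M]

/-- A submersion has differentiable local sections through every point. -/
lemma exists_local_section [IsManifold 𝓘(ℝ, E) ∞ N] [IsManifold 𝓘(ℝ, F) ∞ M] {f : N → M} {x : N}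
    (h : Manifold.IsSubmersionAt 𝓘(ℝ, E) 𝓘(ℝ, F) ∞ f x) :
    ∃ ρ : M → N, ρ (f x) = x ∧ MDifferentiableAt 𝓘(ℝ, F) 𝓘(ℝ, E) ρ (f x) ∧
      ∀ᶠ y in 𝓝 (f x), f (ρ y) = y := by
  have : IsManifold 𝓘(ℝ, E) 1 N := IsManifold.of_le (n := ∞) (by simp)
  have : IsManifold 𝓘(ℝ, F) 1 M := IsManifold.of_le (n := ∞) (by simp)
  set ψ := h.domChart
  set φ := h.codChart
  have hx : x ∈ ψ.source := h.mem_domChart_source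
  have hfx : f x ∈ φ.source := h.mem_codChart_source
  have hψ : ψ ∈ IsManifold.maximalAtlas 𝓘(ℝ, E) 1 N :=
    IsManifold.maximalAtlas_subset_of_le (by simp) h.domChart_mem_maximalAtlas
  have hφ : φ ∈ IsManifold.maximalAtlas 𝓘(ℝ, F) 1 M :=
    IsManifold.maximalAtlas_subset_of_le (by simp) h.codChart_mem_maximalAtlas
  have hw : ∀ z ∈ ψ.target, φ (f (ψ.symm z)) = (h.equiv z).1 := by
    intro z hz
    have h1 : z ∈ (h.domChart.extend 𝓘(ℝ, E)).target := by simpa using hz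
    simpa using h.writtenInCharts h1
  let v := (h.equiv (ψ x)).2
  -- In adapted charts f is a linear projection; the section freezes the complementary coordinate at
  -- its value at x.
  let σ : M → E := fun y => h.equiv.symm (φ y, v)
  have hσ0 : σ (f x) = ψ x := by
    have h1 := hw (ψ x) (ψ.map_source hx)
    rw [ψ.left_inv hx] at h1
    simp [σ, v, h1]
  have hφd : MDifferentiableAt 𝓘(ℝ, F) 𝓘(ℝ, F) φ (f x) :=
    mdifferentiableAt_of_mem_maximalAtlas hφ hfx
  have hσd : MDifferentiableAt 𝓘(ℝ, F) 𝓘(ℝ, E) σ (f x) := by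
    have h2 : DifferentiableAt ℝ (fun z : F => h.equiv.symm (z, v)) (φ (f x)) := by fun_prop
    exact h2.mdifferentiableAt.comp (f x) hφd
  have hψd : MDifferentiableAt 𝓘(ℝ, E) 𝓘(ℝ, E) ψ.symm (σ (f x)) := by
    rw [hσ0]
    exact mdifferentiableAt_symm_of_mem_maximalAtlas hψ (ψ.map_source hx)
  refine ⟨fun y => ψ.symm (σ y), ?_, hψd.comp (f x) hσd, ?_⟩
  · change ψ.symm (σ (f x)) = x
    rw [hσ0, ψ.left_inv hx]
  · have h3 : ∀ᶠ y in 𝓝 (f x), σ y ∈ ψ.target := hσd.continuousAt.eventually_mem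
      (ψ.open_target.mem_nhds (by rw [hσ0]; exact ψ.map_source hx))
    filter_upwards [h3, φ.open_source.mem_nhds hfx] with y hy hy'
    refine φ.injOn (h.source_subset_preimage_source (ψ.map_target hy)) hy' ?_
    rw [hw _ hy]
    simp [σ]

lemma mfderiv_surjective_of_isSubmersionAt [IsManifold 𝓘(ℝ, E) ∞ N] [IsManifold 𝓘(ℝ, F) ∞ M]
    {f : N → M} {x : N} (h : Manifold.IsSubmersionAt 𝓘(ℝ, E) 𝓘(ℝ, F) ∞ f x) :
    Function.Surjective (mfderiv 𝓘(ℝ, E) 𝓘(ℝ, F) f x) := by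
  obtain ⟨ρ, hρx, hρ, hfρ⟩ := exists_local_section h
  have hf : MDifferentiableAt 𝓘(ℝ, E) 𝓘(ℝ, F) f x := h.contMDiffAt.mdifferentiableAt (by simp)
  have hf' : HasMFDerivAt 𝓘(ℝ, E) 𝓘(ℝ, F) f (ρ (f x)) (mfderiv 𝓘(ℝ, E) 𝓘(ℝ, F) f (ρ (f x))) := by
    rw [hρx]; exact hf.hasMFDerivAt
  have h1 := hf'.comp (f x) hρ.hasMFDerivAt
  have h2 : HasMFDerivAt 𝓘(ℝ, F) 𝓘(ℝ, F) (f ∘ ρ) (f x)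
      (ContinuousLinearMap.id ℝ (TangentSpace 𝓘(ℝ, F) (f x))) :=
    (hasMFDerivAt_id (f x)).congr_of_eventuallyEq hfρ
  have h3 := hasMFDerivAt_unique h1 h2
  intro v
  refine ⟨(mfderiv 𝓘(ℝ, F) 𝓘(ℝ, E) ρ (f x) v : E), ?_⟩
  have h4 := DFunLike.congr_fun h3 v
  rw [hρx] at h4
  exact h4

lemma hasMFDerivAt_iff_hasFDerivAt_written {f : N → M} {x : N} {f' : E →L[ℝ] F} :
    HasMFDerivAt 𝓘(ℝ, E) 𝓘(ℝ, F) f x (f' :) ↔ ContinuousAt f x ∧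
      HasFDerivAt (writtenInExtChartAt 𝓘(ℝ, E) 𝓘(ℝ, F) x f) f' (extChartAt 𝓘(ℝ, E) x x) := by
  rw [← hasFDerivWithinAt_univ, ← ModelWithCorners.range_eq_univ 𝓘(ℝ, E)]
  exact Iff.rfl

lemma hasMFDerivAt_curve_iff {c : ℝ → N} {x : N} (hc : c 0 = x) {c' : ℝ →L[ℝ] E} :
    HasMFDerivAt 𝓘(ℝ, ℝ) 𝓘(ℝ, E) c 0 (c' :) ↔ ContinuousAt c 0 ∧
      HasFDerivAt (fun τ => extChartAt 𝓘(ℝ, E) x (c τ)) c' 0 := by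
  subst hc
  exact hasMFDerivAt_iff_hasFDerivAt_written

/-- The tangent map of `ℝ → E` with velocity `v`. -/
abbrev velocity (v : E) : ℝ →L[ℝ] E := ContinuousLinearMap.toSpanSingleton ℝ v

/-- Adjoining a projection π onto ker f' makes z ↦ (f z, π z) a local diffeomorphism. Its inverse is
applied to τ ↦ (β τ, π (a + τ Y)), whose second entry adjusts the velocity of the lift to Y. -/
lemma exists_curve_lift_of_hasStrictFDerivAt [CompleteSpace E] [FiniteDimensional ℝ F]
    {f : E → F} {f' : E →L[ℝ] F} {a : E} (hf : HasStrictFDerivAt f f' a)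
    (hf' : Function.Surjective f') {β : ℝ → F} {Y : E} (hβ : HasFDerivAt β (velocity (f' Y)) 0)
    (hβ0 : β 0 = f a) :
    ∃ c : ℝ → E, c 0 = a ∧ HasFDerivAt c (velocity Y) 0 ∧ ∀ᶠ τ in 𝓝 0, f (c τ) = β τ := by
  have := FiniteDimensional.complete ℝ F
  have hr : f'.range = ⊤ := LinearMap.range_eq_top.2 hf'
  obtain ⟨π, hπ⟩ := f'.ker_closedComplemented_of_finiteDimensional_range
  have hπr : π.range = ⊤ := LinearMap.range_eq_of_proj hπ
  let L := ContinuousLinearMap.equivProdOfSurjectiveOfIsCompl f' π hr hπr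
    (LinearMap.isCompl_of_proj hπ)
  have hL : ∀ z, L z = (f' z, π z) := fun z => rfl
  have hh : HasStrictFDerivAt (fun z => (f z, π z)) (L : E →L[ℝ] F × f'.ker) a :=
    hf.prodMk π.hasStrictFDerivAt
  have hc := hh.to_localInverse.hasFDerivAt
  have hγ : HasFDerivAt (fun τ : ℝ => (β τ, π (a + τ • Y)))
      ((velocity (f' Y)).prod (π.comp (velocity Y))) 0 := by
    refine hβ.prodMk (π.hasFDerivAt.comp 0 ?_)
    exact ((velocity Y).hasFDerivAt.const_add a)
  have hγ0 : (fun τ : ℝ => (β τ, π (a + τ • Y))) 0 = (f a, π a) := by simp [hβ0]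
  refine ⟨fun τ => hh.localInverse _ _ _ (β τ, π (a + τ • Y)), ?_, ?_, ?_⟩
  · change hh.localInverse _ _ _ ((fun τ : ℝ => (β τ, π (a + τ • Y))) 0) = a
    rw [hγ0]
    exact hh.localInverse_apply_image
  · rw [← hγ0] at hc
    refine (hc.comp 0 hγ).congr_fderiv ?_
    ext
    simp only [ContinuousLinearMap.comp_apply, ContinuousLinearEquiv.coe_coe]
    rw [ContinuousLinearEquiv.symm_apply_eq, hL]
    simp
  · have h1 := hh.eventually_right_inverse
    have h2 : Filter.Tendsto (fun τ : ℝ => (β τ, π (a + τ • Y))) (𝓝 0) (𝓝 (f a, π a)) := by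
      rw [← hγ0]; exact hγ.continuousAt
    filter_upwards [h2.eventually h1] with τ hτ
    exact congrArg Prod.fst hτ

lemma exists_curve_lift [IsManifold 𝓘(ℝ, E) ∞ N] [IsManifold 𝓘(ℝ, F) ∞ M] [CompleteSpace E]
    [FiniteDimensional ℝ F] {f : N → M} {x : N}
    (h : Manifold.IsSubmersionAt 𝓘(ℝ, E) 𝓘(ℝ, F) ∞ f x) {β : ℝ → M} {Y : E} {b : ℝ →L[ℝ] F}
    (hβ0 : β 0 = f x) (hβ : HasMFDerivAt 𝓘(ℝ, ℝ) 𝓘(ℝ, F) β 0 b)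
    (hb : b 1 = mfderiv 𝓘(ℝ, E) 𝓘(ℝ, F) f x Y) :
    ∃ c : ℝ → N, c 0 = x ∧ HasMFDerivAt 𝓘(ℝ, ℝ) 𝓘(ℝ, E) c 0 (velocity (E := E) Y :) ∧
      ∀ᶠ τ in 𝓝 0, f (c τ) = β τ := by
  have hf : ContMDiffAt 𝓘(ℝ, E) 𝓘(ℝ, F) ∞ f x := h.contMDiffAt
  have hfd : MDifferentiableAt 𝓘(ℝ, E) 𝓘(ℝ, F) f x := hf.mdifferentiableAt (by simp)
  have hsurj := mfderiv_surjective_of_isSubmersionAt h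
  have hw : ContDiffAt ℝ ∞ (writtenInExtChartAt 𝓘(ℝ, E) 𝓘(ℝ, F) x f)
      (extChartAt 𝓘(ℝ, E) x x) := by
    have := (contMDiffAt_iff.1 hf).2
    simpa [writtenInExtChartAt, contDiffWithinAt_univ] using this
  let f' : E →L[ℝ] F := mfderiv 𝓘(ℝ, E) 𝓘(ℝ, F) f x
  have hstrict : HasStrictFDerivAt (writtenInExtChartAt 𝓘(ℝ, E) 𝓘(ℝ, F) x f) f'
      (extChartAt 𝓘(ℝ, E) x x) := by
    refine hw.hasStrictFDerivAt' ?_ (by simp)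
    exact (hasMFDerivAt_iff_hasFDerivAt_written.1 hfd.hasMFDerivAt).2
  have hβ' : HasFDerivAt (fun τ => extChartAt 𝓘(ℝ, F) (f x) (β τ)) (velocity (f' Y)) 0 := by
    have h2 : b = velocity (f' Y) := by
      ext
      exact hb.trans (show f' Y = velocity (f' Y) 1 by simp)
    rw [h2] at hβ
    exact ((hasMFDerivAt_curve_iff hβ0).1 hβ).2
  obtain ⟨c, hc0, hc, hfc⟩ := exists_curve_lift_of_hasStrictFDerivAt hstrict hsurj hβ'
    (by simp [writtenInExtChartAt, hβ0])
  have hct : ∀ᶠ τ in 𝓝 0, c τ ∈ (extChartAt 𝓘(ℝ, E) x).target :=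
    hc.continuousAt.eventually_mem (by rw [hc0]; exact extChartAt_target_mem_nhds x)
  have hcc : ContinuousAt (fun τ => (extChartAt 𝓘(ℝ, E) x).symm (c τ)) 0 := by
    refine ContinuousAt.comp ?_ hc.continuousAt
    rw [hc0]; exact continuousAt_extChartAt_symm x
  have hG0 : (extChartAt 𝓘(ℝ, E) x).symm (c 0) = x := by rw [hc0]; exact extChartAt_to_inv x
  refine ⟨fun τ => (extChartAt 𝓘(ℝ, E) x).symm (c τ), hG0, (hasMFDerivAt_curve_iff hG0).2 ⟨hcc, ?_⟩, ?_⟩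
  · exact hc.congr_of_eventuallyEq (hct.mono fun τ hτ => (extChartAt 𝓘(ℝ, E) x).right_inv hτ)
  · have h1 : ∀ᶠ τ in 𝓝 (0 : ℝ), f ((extChartAt 𝓘(ℝ, E) x).symm (c τ)) ∈
        (extChartAt 𝓘(ℝ, F) (f x)).source := by
      have : ContinuousAt (fun τ => f ((extChartAt 𝓘(ℝ, E) x).symm (c τ))) 0 := by
        refine ContinuousAt.comp ?_ hcc
        rw [hG0]; exact hf.continuousAt
      refine this.eventually_mem ?_
      rw [hG0]; exact extChartAt_source_mem_nhds (f x)
    have h2 : ∀ᶠ τ in 𝓝 (0 : ℝ), β τ ∈ (extChartAt 𝓘(ℝ, F) (f x)).source := by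
      refine hβ.1.eventually_mem ?_
      rw [hβ0]; exact extChartAt_source_mem_nhds (f x)
    -- Near 0 both points lie in the chart domain, where equal coordinates mean equal points.
    filter_upwards [hfc, h1, h2] with τ h3 h1 h2
    exact (extChartAt 𝓘(ℝ, F) (f x)).injOn h1 h2 h3

/-- Every tangent vector is the velocity of a curve. -/
lemma exists_curve [IsManifold 𝓘(ℝ, E) ∞ N] (x : N) (X : E) :
    ∃ c : ℝ → N, c 0 = x ∧ HasMFDerivAt 𝓘(ℝ, ℝ) 𝓘(ℝ, E) c 0 (velocity (E := E) X :) := by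
  let c : ℝ → E := fun τ => extChartAt 𝓘(ℝ, E) x x + τ • X
  have hc0 : c 0 = extChartAt 𝓘(ℝ, E) x x := by simp [c]
  have hc : HasFDerivAt c (velocity X) 0 := (velocity X).hasFDerivAt.const_add _
  have hct : ∀ᶠ τ in 𝓝 0, c τ ∈ (extChartAt 𝓘(ℝ, E) x).target :=
    hc.continuousAt.eventually_mem (by rw [hc0]; exact extChartAt_target_mem_nhds x)
  have hcc : ContinuousAt (fun τ => (extChartAt 𝓘(ℝ, E) x).symm (c τ)) 0 := by
    refine ContinuousAt.comp ?_ hc.continuousAt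
    rw [hc0]; exact continuousAt_extChartAt_symm x
  have hG0 : (extChartAt 𝓘(ℝ, E) x).symm (c 0) = x := by rw [hc0]; exact extChartAt_to_inv x
  refine ⟨fun τ => (extChartAt 𝓘(ℝ, E) x).symm (c τ), hG0, (hasMFDerivAt_curve_iff hG0).2 ⟨hcc, ?_⟩⟩
  exact hc.congr_of_eventuallyEq (hct.mono fun τ hτ => (extChartAt 𝓘(ℝ, E) x).right_inv hτ)

end

/-! ### Differentiated groupoid identities. -/

namespace LieGroupoid

variable {EG : Type*} [NormedAddCommGroup EG] [NormedSpace ℝ EG]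
  {EM : Type*} [NormedAddCommGroup EM] [NormedSpace ℝ EM]
  {G : Type*} [TopologicalSpace G] [ChartedSpace EG G]
  {M : Type*} [TopologicalSpace M] [ChartedSpace EM M]
  (𝒢 : LieGroupoid EG EM G M)

/-- The derivative of the source map, between the model spaces. -/
def dS (γ : G) : EG →L[ℝ] EM := mfderiv 𝓘(ℝ, EG) 𝓘(ℝ, EM) 𝒢.s γ

/-- The derivative of the target map, between the model spaces. -/
def dT (γ : G) : EG →L[ℝ] EM := mfderiv 𝓘(ℝ, EG) 𝓘(ℝ, EM) 𝒢.t γ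

/-- The derivative of the unit map, between the model spaces. -/
def dU (x : M) : EM →L[ℝ] EG := mfderiv 𝓘(ℝ, EM) 𝓘(ℝ, EG) 𝒢.unit x

/-- The derivative of the inverse, between the model spaces. -/
def dI (γ : G) : EG →L[ℝ] EG := mfderiv 𝓘(ℝ, EG) 𝓘(ℝ, EG) 𝒢.inv γ

/-- The derivative of the multiplication, between the model spaces. -/
def dM (γ η : G) : EG × EG →L[ℝ] EG :=
  mfderivWithin (𝓘(ℝ, EG).prod 𝓘(ℝ, EG)) 𝓘(ℝ, EG) (Function.uncurry 𝒢.mul) 𝒢.nerve₂ (γ, η)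

/-- Bracket (γ⁻¹)⁻¹ γ⁻¹ γ in the two possible ways. -/
lemma inv_inv (γ : G) : 𝒢.inv (𝒢.inv γ) = γ := by
  have h1 := 𝒢.mul_assoc (𝒢.inv (𝒢.inv γ)) (𝒢.inv γ) γ (by rw [𝒢.s_inv]) (by rw [𝒢.s_inv])
  rw [𝒢.inv_mul, 𝒢.inv_mul, 𝒢.s_inv, 𝒢.unit_mul] at h1
  have h2 := 𝒢.mul_unit (𝒢.inv (𝒢.inv γ))
  rw [𝒢.s_inv, 𝒢.t_inv] at h2
  exact h2.symm.trans h1.symm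

section Derivatives

variable {𝒢}

lemma hasMFDerivAt_s (γ : G) : HasMFDerivAt 𝓘(ℝ, EG) 𝓘(ℝ, EM) 𝒢.s γ (𝒢.dS γ :) :=
  ((𝒢.submersion_s.contMDiff γ).mdifferentiableAt (by simp)).hasMFDerivAt

lemma hasMFDerivAt_t (γ : G) : HasMFDerivAt 𝓘(ℝ, EG) 𝓘(ℝ, EM) 𝒢.t γ (𝒢.dT γ :) :=
  ((𝒢.submersion_t.contMDiff γ).mdifferentiableAt (by simp)).hasMFDerivAt

lemma hasMFDerivAt_unit (x : M) : HasMFDerivAt 𝓘(ℝ, EM) 𝓘(ℝ, EG) 𝒢.unit x (𝒢.dU x :) :=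
  ((𝒢.smooth_unit x).mdifferentiableAt (by simp)).hasMFDerivAt

lemma hasMFDerivAt_inv (γ : G) : HasMFDerivAt 𝓘(ℝ, EG) 𝓘(ℝ, EG) 𝒢.inv γ (𝒢.dI γ :) :=
  ((𝒢.smooth_inv γ).mdifferentiableAt (by simp)).hasMFDerivAt

/-- The chain rule for products of composable families. -/
lemma hasMFDerivAt_mul {F : Type*} [NormedAddCommGroup F] [NormedSpace ℝ F]
    {N : Type*} [TopologicalSpace N] [ChartedSpace F N] {a b : N → G} {x : N}
    {a' b' : F →L[ℝ] EG} (ha : HasMFDerivAt 𝓘(ℝ, F) 𝓘(ℝ, EG) a x (a' :))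
    (hb : HasMFDerivAt 𝓘(ℝ, F) 𝓘(ℝ, EG) b x (b' :))
    (hab : ∀ᶠ y in 𝓝 x, 𝒢.s (a y) = 𝒢.t (b y)) :
    HasMFDerivAt 𝓘(ℝ, F) 𝓘(ℝ, EG) (fun y => 𝒢.mul (a y) (b y)) x
      ((𝒢.dM (a x) (b x)).comp (a'.prod b') :) := by
  have h1 : HasMFDerivAt 𝓘(ℝ, F) (𝓘(ℝ, EG).prod 𝓘(ℝ, EG)) (fun y => (a y, b y)) x
      (a'.prod b' :) := ha.prodMk hb
  have h2 : HasMFDerivWithinAt (𝓘(ℝ, EG).prod 𝓘(ℝ, EG)) 𝓘(ℝ, EG) (Function.uncurry 𝒢.mul)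
      𝒢.nerve₂ (a x, b x) (𝒢.dM (a x) (b x) :) :=
    ((𝒢.smooth_mul (a x, b x) hab.self_of_nhds).mdifferentiableWithinAt
      (by simp)).hasMFDerivWithinAt
  have h3 := HasMFDerivWithinAt.comp (s := (fun y => (a y, b y)) ⁻¹' 𝒢.nerve₂) x h2
    h1.hasMFDerivWithinAt subset_rfl
  exact h3.hasMFDerivAt hab

lemma dT_dU (x : M) (u : EM) : 𝒢.dT (𝒢.unit x) (𝒢.dU x u) = u := by
  have h1 := (hasMFDerivAt_t (𝒢 := 𝒢) (𝒢.unit x)).comp x (hasMFDerivAt_unit (𝒢 := 𝒢) x)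
  have h2 : HasMFDerivAt 𝓘(ℝ, EM) 𝓘(ℝ, EM) (𝒢.t ∘ 𝒢.unit) x (ContinuousLinearMap.id ℝ EM :) :=
    (hasMFDerivAt_id x).congr_of_eventuallyEq (Filter.Eventually.of_forall 𝒢.t_unit)
  exact DFunLike.congr_fun (hasMFDerivAt_unique h1 h2) u

lemma dS_dI (γ : G) (X : EG) : 𝒢.dS (𝒢.inv γ) (𝒢.dI γ X) = 𝒢.dT γ X := by
  have h1 := (hasMFDerivAt_s (𝒢 := 𝒢) (𝒢.inv γ)).comp γ (hasMFDerivAt_inv (𝒢 := 𝒢) γ)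
  have h2 : HasMFDerivAt 𝓘(ℝ, EG) 𝓘(ℝ, EM) (𝒢.s ∘ 𝒢.inv) γ (𝒢.dT γ :) :=
    (hasMFDerivAt_t (𝒢 := 𝒢) γ).congr_of_eventuallyEq (Filter.Eventually.of_forall 𝒢.s_inv)
  exact DFunLike.congr_fun (hasMFDerivAt_unique h1 h2) X

lemma dT_dI (γ : G) (X : EG) : 𝒢.dT (𝒢.inv γ) (𝒢.dI γ X) = 𝒢.dS γ X := by
  have h1 := (hasMFDerivAt_t (𝒢 := 𝒢) (𝒢.inv γ)).comp γ (hasMFDerivAt_inv (𝒢 := 𝒢) γ)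
  have h2 : HasMFDerivAt 𝓘(ℝ, EG) 𝓘(ℝ, EM) (𝒢.t ∘ 𝒢.inv) γ (𝒢.dS γ :) :=
    (hasMFDerivAt_s (𝒢 := 𝒢) γ).congr_of_eventuallyEq (Filter.Eventually.of_forall 𝒢.t_inv)
  exact DFunLike.congr_fun (hasMFDerivAt_unique h1 h2) X

lemma dI_dI (γ : G) (X : EG) : 𝒢.dI (𝒢.inv γ) (𝒢.dI γ X) = X := by
  have h1 := (hasMFDerivAt_inv (𝒢 := 𝒢) (𝒢.inv γ)).comp γ (hasMFDerivAt_inv (𝒢 := 𝒢) γ)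
  have h2 : HasMFDerivAt 𝓘(ℝ, EG) 𝓘(ℝ, EG) (𝒢.inv ∘ 𝒢.inv) γ (ContinuousLinearMap.id ℝ EG :) :=
    (hasMFDerivAt_id γ).congr_of_eventuallyEq (Filter.Eventually.of_forall 𝒢.inv_inv)
  exact DFunLike.congr_fun (hasMFDerivAt_unique h1 h2) X

lemma dM_dU_right (γ : G) (X : EG) :
    𝒢.dM γ (𝒢.unit (𝒢.s γ)) (X, 𝒢.dU (𝒢.s γ) (𝒢.dS γ X)) = X := by
  have h0 : HasMFDerivAt 𝓘(ℝ, EG) 𝓘(ℝ, EG) (fun y => 𝒢.unit (𝒢.s y)) γ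
      ((𝒢.dU (𝒢.s γ)).comp (𝒢.dS γ) :) := (hasMFDerivAt_unit (𝒢 := 𝒢) (𝒢.s γ)).comp γ (hasMFDerivAt_s (𝒢 := 𝒢) γ)
  have h1 := hasMFDerivAt_mul (𝒢 := 𝒢) (a := id) (a' := ContinuousLinearMap.id ℝ EG)
    (hasMFDerivAt_id γ) h0 (Filter.Eventually.of_forall fun y => (𝒢.t_unit _).symm)
  have h2 : HasMFDerivAt 𝓘(ℝ, EG) 𝓘(ℝ, EG) (fun y => 𝒢.mul (id y) (𝒢.unit (𝒢.s y))) γ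
      (ContinuousLinearMap.id ℝ EG :) :=
    (hasMFDerivAt_id γ).congr_of_eventuallyEq (Filter.Eventually.of_forall 𝒢.mul_unit)
  exact DFunLike.congr_fun (hasMFDerivAt_unique h1 h2) X

lemma dM_dU_left (γ : G) (X : EG) :
    𝒢.dM (𝒢.unit (𝒢.t γ)) γ (𝒢.dU (𝒢.t γ) (𝒢.dT γ X), X) = X := by
  have h0 : HasMFDerivAt 𝓘(ℝ, EG) 𝓘(ℝ, EG) (fun y => 𝒢.unit (𝒢.t y)) γ
      ((𝒢.dU (𝒢.t γ)).comp (𝒢.dT γ) :) := (hasMFDerivAt_unit (𝒢 := 𝒢) (𝒢.t γ)).comp γ (hasMFDerivAt_t (𝒢 := 𝒢) γ)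
  have h1 := hasMFDerivAt_mul (𝒢 := 𝒢) (b := id) (b' := ContinuousLinearMap.id ℝ EG)
    h0 (hasMFDerivAt_id γ) (Filter.Eventually.of_forall fun y => 𝒢.s_unit _)
  have h2 : HasMFDerivAt 𝓘(ℝ, EG) 𝓘(ℝ, EG) (fun y => 𝒢.mul (𝒢.unit (𝒢.t y)) (id y)) γ
      (ContinuousLinearMap.id ℝ EG :) :=
    (hasMFDerivAt_id γ).congr_of_eventuallyEq (Filter.Eventually.of_forall 𝒢.unit_mul)
  exact DFunLike.congr_fun (hasMFDerivAt_unique h1 h2) X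

lemma dM_dI (γ : G) (X : EG) :
    𝒢.dM γ (𝒢.inv γ) (X, 𝒢.dI γ X) = 𝒢.dU (𝒢.t γ) (𝒢.dT γ X) := by
  have h1 := hasMFDerivAt_mul (𝒢 := 𝒢) (a := id) (a' := ContinuousLinearMap.id ℝ EG)
    (hasMFDerivAt_id γ) (hasMFDerivAt_inv (𝒢 := 𝒢) γ)
    (Filter.Eventually.of_forall fun y => (𝒢.t_inv _).symm)
  have h2 : HasMFDerivAt 𝓘(ℝ, EG) 𝓘(ℝ, EG) (fun y => 𝒢.mul (id y) (𝒢.inv y)) γ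
      ((𝒢.dU (𝒢.t γ)).comp (𝒢.dT γ) :) :=
    ((hasMFDerivAt_unit (𝒢 := 𝒢) (𝒢.t γ)).comp γ (hasMFDerivAt_t (𝒢 := 𝒢) γ)).congr_of_eventuallyEq
      (Filter.Eventually.of_forall 𝒢.mul_inv)
  exact DFunLike.congr_fun (hasMFDerivAt_unique h1 h2) X

variable [IsManifold 𝓘(ℝ, EG) ∞ G] [IsManifold 𝓘(ℝ, EM) ∞ M]

lemma dS_surjective (γ : G) : Function.Surjective (𝒢.dS γ) :=
  mfderiv_surjective_of_isSubmersionAt (𝒢.submersion_s.isSubmersionAt γ)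

lemma dT_surjective (γ : G) : Function.Surjective (𝒢.dT γ) :=
  mfderiv_surjective_of_isSubmersionAt (𝒢.submersion_t.isSubmersionAt γ)

variable [FiniteDimensional ℝ EG] [FiniteDimensional ℝ EM]

/-- The curve s ∘ a is lifted through the submersion t with prescribed velocity Y. Such curves
compute `dM`, a derivative within the set of composable pairs, on every tangent pair. -/
lemma exists_composable_curves {γ η : G} (h : 𝒢.s γ = 𝒢.t η) {X Y : EG}
    (hXY : 𝒢.dS γ X = 𝒢.dT η Y) :
    ∃ a b : ℝ → G, a 0 = γ ∧ b 0 = η ∧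
      HasMFDerivAt 𝓘(ℝ, ℝ) 𝓘(ℝ, EG) a 0 (velocity (E := EG) X :) ∧
      HasMFDerivAt 𝓘(ℝ, ℝ) 𝓘(ℝ, EG) b 0 (velocity (E := EG) Y :) ∧
      ∀ᶠ τ in 𝓝 0, 𝒢.s (a τ) = 𝒢.t (b τ) := by
  have : CompleteSpace EG := FiniteDimensional.complete ℝ EG
  obtain ⟨a, rfl, ha⟩ := exists_curve γ X
  have h1 : HasMFDerivAt 𝓘(ℝ, ℝ) 𝓘(ℝ, EM) (𝒢.s ∘ a) 0 ((𝒢.dS (a 0)).comp (velocity X) :) :=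
    (hasMFDerivAt_s (𝒢 := 𝒢) (a 0)).comp 0 ha
  obtain ⟨b, hb0, hb, hab⟩ := exists_curve_lift (𝒢.submersion_t.isSubmersionAt η) (Y := Y) h h1
    ((show (𝒢.dS (a 0)).comp (velocity X) 1 = 𝒢.dS (a 0) X by simp).trans hXY)
  exact ⟨a, b, rfl, hb0, ha, hb, hab.mono fun τ hτ => hτ.symm⟩

lemma dT_dM {γ η : G} (h : 𝒢.s γ = 𝒢.t η) {X Y : EG} (hXY : 𝒢.dS γ X = 𝒢.dT η Y) :
    𝒢.dT (𝒢.mul γ η) (𝒢.dM γ η (X, Y)) = 𝒢.dT γ X := by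
  obtain ⟨a, b, rfl, rfl, ha, hb, hab⟩ := exists_composable_curves h hXY
  have h1 := (hasMFDerivAt_t (𝒢 := 𝒢) (𝒢.mul (a 0) (b 0))).comp 0 (hasMFDerivAt_mul ha hb hab)
  have h2 := ((hasMFDerivAt_t (𝒢 := 𝒢) (a 0)).comp 0 ha).congr_of_eventuallyEq
    (f₁ := 𝒢.t ∘ fun y => 𝒢.mul (a y) (b y)) (hab.mono fun τ hτ => 𝒢.t_mul _ _ hτ)
  have h3 : 𝒢.dT (𝒢.mul (a 0) (b 0)) (𝒢.dM (a 0) (b 0) (velocity X 1, velocity Y 1)) =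
    𝒢.dT (a 0) (velocity X 1) := DFunLike.congr_fun (hasMFDerivAt_unique h1 h2) (1 : ℝ)
  simpa using h3

end Derivatives
end LieGroupoid

/-! ### Complexification, conjugation and complexified bilinear forms. -/

section Complex

variable {V V' : Type*} [AddCommGroup V] [Module ℝ V] [AddCommGroup V'] [Module ℝ V']

lemma exists_eq_cvec (Z : ℂ ⊗[ℝ] V) : ∃ X Y : V, Z = cvec X Y := by
  induction Z using TensorProduct.induction_on with
  | zero => exact ⟨0, 0, by simp [cvec]⟩
  | tmul a v =>
    refine ⟨a.re • v, a.im • v, ?_⟩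
    rw [cvec, ← TensorProduct.smul_tmul, ← TensorProduct.smul_tmul, ← TensorProduct.add_tmul]
    congr 1
    apply Complex.ext <;> simp
  | add Z Z' h h' =>
    obtain ⟨X, Y, rfl⟩ := h
    obtain ⟨X', Y', rfl⟩ := h'
    exact ⟨X + X', Y + Y', by simp only [cvec, TensorProduct.tmul_add]; abel⟩

lemma cvec_inj {X Y X' Y' : V} : cvec X Y = cvec X' Y' ↔ X = X' ∧ Y = Y' := by
  refine ⟨fun h => ?_, fun h => by rw [h.1, h.2]⟩
  have hre := congrArg (fun Z => TensorProduct.lid ℝ V (Complex.reLm.rTensor V Z)) h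
  have him := congrArg (fun Z => TensorProduct.lid ℝ V (Complex.imLm.rTensor V Z)) h
  simp [cvec] at hre him
  exact ⟨hre, him⟩

lemma cvec_zero_right (X : V) : cvec X 0 = (1 : ℂ) ⊗ₜ[ℝ] X := by simp [cvec]

lemma cvec_zero : cvec (0 : V) 0 = 0 := by simp [cvec]

lemma cvec_add (X Y X' Y' : V) : cvec X Y + cvec X' Y' = cvec (X + X') (Y + Y') := by
  simp only [cvec, TensorProduct.tmul_add]
  abel

lemma baseChange_cvec (f : V →ₗ[ℝ] V') (X Y : V) :
    f.baseChange ℂ (cvec X Y) = cvec (f X) (f Y) := by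
  simp [cvec]

lemma conj_cvec (X Y : V) : conj V (cvec X Y) = cvec X (-Y) := by
  have h : ∀ (a : ℂ) (v : V), conj V (a ⊗ₜ[ℝ] v) = (starRingEnd ℂ a) ⊗ₜ[ℝ] v := fun _ _ => rfl
  simp [cvec, h, TensorProduct.neg_tmul, TensorProduct.tmul_neg]

lemma conj_conj (Z : ℂ ⊗[ℝ] V) : conj V (conj V Z) = Z := by
  obtain ⟨X, Y, rfl⟩ := exists_eq_cvec Z
  rw [conj_cvec, conj_cvec, neg_neg]

lemma conj_baseChange (f : V →ₗ[ℝ] V') (Z : ℂ ⊗[ℝ] V) :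
    conj V' (f.baseChange ℂ Z) = f.baseChange ℂ (conj V Z) := by
  obtain ⟨X, Y, rfl⟩ := exists_eq_cvec Z
  rw [conj_cvec, baseChange_cvec, baseChange_cvec, conj_cvec, map_neg]

lemma mem_conjSubspace {P : Submodule ℂ (ℂ ⊗[ℝ] V)} {Z : ℂ ⊗[ℝ] V} :
    Z ∈ conjSubspace P ↔ conj V Z ∈ P := by
  constructor
  · rintro ⟨W, hW, rfl⟩
    rwa [conj_conj]
  · intro h
    exact ⟨conj V Z, h, conj_conj Z⟩

lemma cvec_eq (X Y : V) :
    cvec X Y = (1 : ℂ) ⊗ₜ[ℝ] X + Complex.I • ((1 : ℂ) ⊗ₜ[ℝ] Y) := by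
  simp [cvec, TensorProduct.smul_tmul']

lemma cvec_add_conj (X Y : V) :
    (1 : ℂ) ⊗ₜ[ℝ] X = (1 / 2 : ℂ) • (cvec X Y + conj V (cvec X Y)) := by
  rw [conj_cvec, cvec_eq, cvec_eq, TensorProduct.tmul_neg]
  module

lemma cvec_sub_conj (X Y : V) :
    (1 : ℂ) ⊗ₜ[ℝ] Y = (-Complex.I / 2) • (cvec X Y - conj V (cvec X Y)) := by
  have h : (-Complex.I / 2) • (cvec X Y - conj V (cvec X Y)) =
      (-(Complex.I * Complex.I)) • ((1 : ℂ) ⊗ₜ[ℝ] Y) := by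
    rw [conj_cvec, cvec_eq, cvec_eq, TensorProduct.tmul_neg]
    module
  rw [h, Complex.I_mul_I, neg_neg, one_smul]

lemma bilinBaseChange_tmul (B : LinearMap.BilinForm ℝ V) (X Y : V) :
    B.baseChange ℂ ((1 : ℂ) ⊗ₜ[ℝ] X) ((1 : ℂ) ⊗ₜ[ℝ] Y) = (B X Y : ℂ) := by
  simp

lemma bilinBaseChange_cvec (B : LinearMap.BilinForm ℝ V) (X Y X' Y' : V) :
    B.baseChange ℂ (cvec X Y) (cvec X' Y') =
      ((B X X' - B Y Y' : ℝ) : ℂ) + Complex.I * ((B X Y' + B Y X' : ℝ) : ℂ) := by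
  simp only [cvec_eq, map_add, map_smul, LinearMap.add_apply, LinearMap.smul_apply,
    bilinBaseChange_tmul, smul_eq_mul]
  push_cast
  linear_combination (B Y Y' : ℂ) * Complex.I_mul_I

lemma bilinBaseChange_conj (B : LinearMap.BilinForm ℝ V) (Z W : ℂ ⊗[ℝ] V) :
    B.baseChange ℂ (conj V Z) (conj V W) = starRingEnd ℂ (B.baseChange ℂ Z W) := by
  obtain ⟨X, Y, rfl⟩ := exists_eq_cvec Z
  obtain ⟨X', Y', rfl⟩ := exists_eq_cvec W
  simp only [conj_cvec, bilinBaseChange_cvec, map_neg, LinearMap.neg_apply]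
  apply Complex.ext <;> simp
  ring

lemma bilinBaseChange_separatingLeft {B : LinearMap.BilinForm ℝ V}
    (hB : ∀ X, (∀ Y, B X Y = 0) → X = 0) {Z : ℂ ⊗[ℝ] V} (hZ : ∀ W, B.baseChange ℂ Z W = 0) :
    Z = 0 := by
  obtain ⟨X, Y, rfl⟩ := exists_eq_cvec Z
  have h : ∀ Y', B X Y' = 0 ∧ B Y Y' = 0 := by
    intro Y'
    have h1 := hZ (cvec Y' 0)
    rw [bilinBaseChange_cvec] at h1
    exact ⟨by simpa using congrArg Complex.re h1, by simpa using congrArg Complex.im h1⟩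
  rw [hB X fun Y' => (h Y').1, hB Y fun Y' => (h Y').2, cvec_zero]

lemma bilinBaseChange_swap {B : LinearMap.BilinForm ℝ V} (hB : B.IsAlt) (Z W : ℂ ⊗[ℝ] V) :
    B.baseChange ℂ Z W = -B.baseChange ℂ W Z := by
  have hswap : ∀ x y, B x y = -B y x := fun x y => (hB.neg_eq y x).symm
  obtain ⟨X, Y, rfl⟩ := exists_eq_cvec Z
  obtain ⟨X', Y', rfl⟩ := exists_eq_cvec W
  simp only [bilinBaseChange_cvec]
  rw [hswap X' X, hswap Y' Y, hswap X' Y, hswap Y' X]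
  push_cast
  ring

/-- P is its own orthogonal, and for a nondegenerate form the orthogonal has complementary
dimension. -/
lemma finrank_of_isLagrangian [FiniteDimensional ℝ V] {B : LinearMap.BilinForm ℝ V}
    (hB : B.IsAlt) (hnd : ∀ X, (∀ Y, B X Y = 0) → X = 0) {P : Submodule ℂ (ℂ ⊗[ℝ] V)}
    (hP : ∀ Z, Z ∈ P ↔ ∀ W ∈ P, B.baseChange ℂ Z W = 0) :
    2 * Module.finrank ℂ P = Module.finrank ℝ V := by
  have hswap := bilinBaseChange_swap hB
  have hnd' : (B.baseChange ℂ).Nondegenerate :=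
    ⟨fun Z hZ => bilinBaseChange_separatingLeft hnd hZ, fun Z hZ =>
      bilinBaseChange_separatingLeft hnd fun W => by rw [hswap, hZ, neg_zero]⟩
  have hrefl : (B.baseChange ℂ).IsRefl := fun Z W h => by rw [hswap, h, neg_zero]
  have horth : (B.baseChange ℂ).orthogonal P = P := by
    ext Z
    rw [LinearMap.BilinForm.mem_orthogonal_iff, hP]
    exact forall₂_congr fun W _ => ⟨hrefl W Z, hrefl Z W⟩
  have h := LinearMap.BilinForm.finrank_orthogonal hnd' P
  rw [horth, Module.finrank_baseChange] at h
  -- The dimension of the orthogonal is a truncated difference; this bound makes it a true one.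
  have h' := P.finrank_le
  rw [Module.finrank_baseChange] at h'
  omega

end Complex

/-! ### Complexified tangent maps of the groupoid. -/

namespace LieGroupoid

variable {EG : Type*} [NormedAddCommGroup EG] [NormedSpace ℝ EG]
  {EM : Type*} [NormedAddCommGroup EM] [NormedSpace ℝ EM]
  {G : Type*} [TopologicalSpace G] [ChartedSpace EG G]
  {M : Type*} [TopologicalSpace M] [ChartedSpace EM M]
  (𝒢 : LieGroupoid EG EM G M)

/-- The complexified derivative of the source map, between the model spaces. -/
def cS (γ : G) : ℂ ⊗[ℝ] EG →ₗ[ℂ] ℂ ⊗[ℝ] EM := (𝒢.dS γ).toLinearMap.baseChange ℂ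

/-- The complexified derivative of the target map, between the model spaces. -/
def cT (γ : G) : ℂ ⊗[ℝ] EG →ₗ[ℂ] ℂ ⊗[ℝ] EM := (𝒢.dT γ).toLinearMap.baseChange ℂ

/-- The complexified derivative of the unit map, between the model spaces. -/
def cU (x : M) : ℂ ⊗[ℝ] EM →ₗ[ℂ] ℂ ⊗[ℝ] EG := (𝒢.dU x).toLinearMap.baseChange ℂ

/-- The complexified derivative of the inverse, between the model spaces. -/
def cI (γ : G) : ℂ ⊗[ℝ] EG →ₗ[ℂ] ℂ ⊗[ℝ] EG := (𝒢.dI γ).toLinearMap.baseChange ℂ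

/-- The complexified derivative of the multiplication, between the model spaces. -/
def cM (γ η : G) : (ℂ ⊗[ℝ] EG) × (ℂ ⊗[ℝ] EG) →ₗ[ℂ] ℂ ⊗[ℝ] EG :=
  (((𝒢.dM γ η).toLinearMap ∘ₗ LinearMap.inl ℝ EG EG).baseChange ℂ).coprod
    (((𝒢.dM γ η).toLinearMap ∘ₗ LinearMap.inr ℝ EG EG).baseChange ℂ)

section

variable {𝒢}

lemma cS_cvec (γ : G) (X Y : EG) : 𝒢.cS γ (cvec X Y) = cvec (𝒢.dS γ X) (𝒢.dS γ Y) :=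
  baseChange_cvec _ _ _

lemma cT_cvec (γ : G) (X Y : EG) : 𝒢.cT γ (cvec X Y) = cvec (𝒢.dT γ X) (𝒢.dT γ Y) :=
  baseChange_cvec _ _ _

lemma cU_cvec (x : M) (X Y : EM) : 𝒢.cU x (cvec X Y) = cvec (𝒢.dU x X) (𝒢.dU x Y) :=
  baseChange_cvec _ _ _

lemma cI_cvec (γ : G) (X Y : EG) : 𝒢.cI γ (cvec X Y) = cvec (𝒢.dI γ X) (𝒢.dI γ Y) :=
  baseChange_cvec _ _ _

lemma cM_cvec (γ η : G) (X Y X' Y' : EG) :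
    𝒢.cM γ η (cvec X Y, cvec X' Y') = cvec (𝒢.dM γ η (X, X')) (𝒢.dM γ η (Y, Y')) := by
  rw [cM, LinearMap.coprod_apply, baseChange_cvec, baseChange_cvec, cvec_add]
  simp only [LinearMap.comp_apply, ContinuousLinearMap.coe_coe, ← map_add, LinearMap.inl_apply,
    LinearMap.inr_apply, Prod.mk_add_mk, add_zero, zero_add]

lemma conj_cS (γ : G) (Z : ℂ ⊗[ℝ] EG) : conj EM (𝒢.cS γ Z) = 𝒢.cS γ (conj EG Z) :=
  conj_baseChange _ _

lemma conj_cT (γ : G) (Z : ℂ ⊗[ℝ] EG) : conj EM (𝒢.cT γ Z) = 𝒢.cT γ (conj EG Z) :=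
  conj_baseChange _ _

lemma cT_cU (x : M) (u : ℂ ⊗[ℝ] EM) : 𝒢.cT (𝒢.unit x) (𝒢.cU x u) = u := by
  obtain ⟨X, Y, rfl⟩ := exists_eq_cvec u
  rw [cU_cvec, cT_cvec, dT_dU, dT_dU]

lemma cS_cI (γ : G) (Z : ℂ ⊗[ℝ] EG) : 𝒢.cS (𝒢.inv γ) (𝒢.cI γ Z) = 𝒢.cT γ Z := by
  obtain ⟨X, Y, rfl⟩ := exists_eq_cvec Z
  rw [cI_cvec, cS_cvec, cT_cvec, dS_dI, dS_dI]

lemma cT_cI (γ : G) (Z : ℂ ⊗[ℝ] EG) : 𝒢.cT (𝒢.inv γ) (𝒢.cI γ Z) = 𝒢.cS γ Z := by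
  obtain ⟨X, Y, rfl⟩ := exists_eq_cvec Z
  rw [cI_cvec, cS_cvec, cT_cvec, dT_dI, dT_dI]

lemma cI_cI (γ : G) (Z : ℂ ⊗[ℝ] EG) : 𝒢.cI (𝒢.inv γ) (𝒢.cI γ Z) = Z := by
  obtain ⟨X, Y, rfl⟩ := exists_eq_cvec Z
  rw [cI_cvec, cI_cvec, dI_dI, dI_dI]

lemma cM_cU_right (γ : G) (Z : ℂ ⊗[ℝ] EG) :
    𝒢.cM γ (𝒢.unit (𝒢.s γ)) (Z, 𝒢.cU (𝒢.s γ) (𝒢.cS γ Z)) = Z := by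
  obtain ⟨X, Y, rfl⟩ := exists_eq_cvec Z
  rw [cS_cvec, cU_cvec, cM_cvec, dM_dU_right, dM_dU_right]

lemma cM_cU_left (γ : G) (Z : ℂ ⊗[ℝ] EG) :
    𝒢.cM (𝒢.unit (𝒢.t γ)) γ (𝒢.cU (𝒢.t γ) (𝒢.cT γ Z), Z) = Z := by
  obtain ⟨X, Y, rfl⟩ := exists_eq_cvec Z
  rw [cT_cvec, cU_cvec, cM_cvec, dM_dU_left, dM_dU_left]

lemma cM_cI (γ : G) (Z : ℂ ⊗[ℝ] EG) :
    𝒢.cM γ (𝒢.inv γ) (Z, 𝒢.cI γ Z) = 𝒢.cU (𝒢.t γ) (𝒢.cT γ Z) := by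
  obtain ⟨X, Y, rfl⟩ := exists_eq_cvec Z
  rw [cT_cvec, cU_cvec, cI_cvec, cM_cvec, dM_dI, dM_dI]

lemma cT_cM [IsManifold 𝓘(ℝ, EG) ∞ G] [IsManifold 𝓘(ℝ, EM) ∞ M] [FiniteDimensional ℝ EG]
    [FiniteDimensional ℝ EM] {γ η : G} (h : 𝒢.s γ = 𝒢.t η) {Z W : ℂ ⊗[ℝ] EG}
    (hZW : 𝒢.cS γ Z = 𝒢.cT η W) :
    𝒢.cT (𝒢.mul γ η) (𝒢.cM γ η (Z, W)) = 𝒢.cT γ Z := by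
  obtain ⟨X, Y, rfl⟩ := exists_eq_cvec Z
  obtain ⟨X', Y', rfl⟩ := exists_eq_cvec W
  rw [cS_cvec, cT_cvec, cvec_inj] at hZW
  rw [cM_cvec, cT_cvec, cT_cvec, dT_dM h hZW.1, dT_dM h hZW.2]

end

end LieGroupoid

/-! ### Multiplicativity of ω and orthogonality of the fibres. -/

namespace SymplecticGroupoid

variable {EG : Type*} [NormedAddCommGroup EG] [NormedSpace ℝ EG]
  {EM : Type*} [NormedAddCommGroup EM] [NormedSpace ℝ EM]
  {G : Type*} [TopologicalSpace G] [ChartedSpace EG G] [IsManifold 𝓘(ℝ, EG) ∞ G]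
  {M : Type*} [TopologicalSpace M] [ChartedSpace EM M]
  (S : SymplecticGroupoid EG EM G M)

/-- The symplectic form at a point, as a bilinear form on the model space. -/
def om (γ : G) : LinearMap.BilinForm ℝ EG := S.bilin γ

/-- The complexification of the symplectic form at a point. -/
def cOm (γ : G) : LinearMap.BilinForm ℂ (ℂ ⊗[ℝ] EG) := (S.om γ).baseChange ℂ

variable {S}

lemma om_isAlt (γ : G) : (S.om γ).IsAlt := fun X => S.symp.alternating γ X

lemma om_nondegenerate (γ : G) (X : EG) (h : ∀ Y, S.om γ X Y = 0) : X = 0 :=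
  S.symp.nondegenerate γ X h

lemma om_dM {γ η : G} (h : S.s γ = S.t η) {X X' Y Y' : EG} (hXY : S.dS γ X = S.dT η Y)
    (hXY' : S.dS γ X' = S.dT η Y') :
    S.om (S.mul γ η) (S.dM γ η (X, Y)) (S.dM γ η (X', Y')) = S.om γ X X' + S.om η Y Y' := by
  have h1 : S.om γ X X' - S.om (S.mul γ η) (S.dM γ η (X, Y)) (S.dM γ η (X', Y'))
      + S.om η Y Y' = 0 := S.multiplicative γ η h X X' Y Y' hXY hXY'
  linarith

variable [IsManifold 𝓘(ℝ, EM) ∞ M]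

/-- Left translation is injective on vectors tangent to the target fibres. -/
lemma eq_zero_of_dM_eq_zero {γ η : G} (h : S.s γ = S.t η) {U : EG} (hU : S.dT η U = 0)
    (hU0 : S.dM γ η (0, U) = 0) : U = 0 := by
  refine om_nondegenerate (S := S) η U fun Y => ?_
  -- Y is completed to a composable pair (X, Y); multiplicativity then gives ω(U, Y) = ω(Tm(0, U),
  -- Tm(X, Y)) = 0.
  obtain ⟨X, hX⟩ := S.dS_surjective γ (S.dT η Y)
  have h1 := om_dM h (X := 0) (Y := U) (by rw [map_zero, hU]) hX
  rw [hU0] at h1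
  simpa using h1.symm

lemma eq_zero_of_cM_eq_zero {γ η : G} (h : S.s γ = S.t η) {Z : ℂ ⊗[ℝ] EG} (hZ : S.cT η Z = 0)
    (hZ0 : S.cM γ η (0, Z) = 0) : Z = 0 := by
  obtain ⟨X, Y, rfl⟩ := exists_eq_cvec Z
  rw [LieGroupoid.cT_cvec, ← cvec_zero, cvec_inj] at hZ
  rw [← cvec_zero, LieGroupoid.cM_cvec, cvec_inj] at hZ0
  rw [eq_zero_of_dM_eq_zero h hZ.1 hZ0.1, eq_zero_of_dM_eq_zero h hZ.2 hZ0.2, cvec_zero]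

variable [FiniteDimensional ℝ EG] [FiniteDimensional ℝ EM]

/-- Left translation is onto the vectors tangent to the target fibres. -/
lemma exists_dM_eq {γ : G} {X : EG} (hX : S.dT γ X = 0) :
    ∃ U : EG, S.dT (S.unit (S.s γ)) U = 0 ∧ S.dM γ (S.unit (S.s γ)) (0, U) = X := by
  have hst : S.s γ = S.t (S.unit (S.s γ)) := (S.t_unit _).symm
  have hmaps : ∀ U ∈ LinearMap.ker (S.dT (S.unit (S.s γ))).toLinearMap,
      ((S.dM γ (S.unit (S.s γ))).toLinearMap ∘ₗ LinearMap.inr ℝ EG EG) U ∈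
        LinearMap.ker (S.dT γ).toLinearMap := by
    intro U hU
    have hU' : S.dT (S.unit (S.s γ)) U = 0 := hU
    have h1 := LieGroupoid.dT_dM hst (X := 0) (Y := U) (by rw [map_zero, hU'])
    rw [S.mul_unit, map_zero] at h1
    exact h1
  let L := ((S.dM γ (S.unit (S.s γ))).toLinearMap ∘ₗ LinearMap.inr ℝ EG EG).restrict hmaps
  have hinj : Function.Injective L := by
    rw [← LinearMap.ker_eq_bot, LinearMap.ker_eq_bot']
    intro U hU
    exact Subtype.ext (eq_zero_of_dM_eq_zero hst U.2 (congrArg Subtype.val hU))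
  -- As t is a submersion, all target fibres have the same dimension, so injectivity of the
  -- translation gives surjectivity.
  have hdim : ∀ η : G, Module.finrank ℝ EM +
      Module.finrank ℝ (LinearMap.ker (S.dT η).toLinearMap) = Module.finrank ℝ EG := by
    intro η
    have h1 := LinearMap.finrank_range_add_finrank_ker (S.dT η).toLinearMap
    rwa [LinearMap.range_eq_top.2 (S.dT_surjective η), finrank_top] at h1
  have hsurj : Function.Surjective L :=
    (LinearMap.injective_iff_surjective_of_finrank_eq_finrank (by
      have := hdim γ
      have := hdim (S.unit (S.s γ))
      omega)).1 hinj
  obtain ⟨U, hU⟩ := hsurj ⟨X, hX⟩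
  exact ⟨U, U.2, congrArg Subtype.val hU⟩

/-- The source fibres and the target fibres are symplectically orthogonal. -/
lemma om_eq_zero {γ : G} {X Y : EG} (hX : S.dT γ X = 0) (hY : S.dS γ Y = 0) :
    S.om γ X Y = 0 := by
  -- With X = Tm(0, U) and Y = Tm(Y, 0), multiplicativity gives ω(X, Y) = ω(0, Y) + ω(U, 0) = 0.
  obtain ⟨U, hU, rfl⟩ := exists_dM_eq hX
  have h1 := om_dM (S.t_unit (S.s γ)).symm (X := 0) (X' := Y) (Y := U) (Y' := 0)
    (by rw [map_zero, hU]) (by rw [hY, map_zero])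
  have h2 := LieGroupoid.dM_dU_right (𝒢 := S.toLieGroupoid) γ Y
  rw [hY, map_zero] at h2
  rw [S.mul_unit, h2] at h1
  simpa using h1

lemma cOm_eq_zero {γ : G} {Z W : ℂ ⊗[ℝ] EG} (hZ : S.cT γ Z = 0) (hW : S.cS γ W = 0) :
    S.cOm γ Z W = 0 := by
  obtain ⟨X, Y, rfl⟩ := exists_eq_cvec Z
  obtain ⟨X', Y', rfl⟩ := exists_eq_cvec W
  rw [LieGroupoid.cT_cvec, ← cvec_zero, cvec_inj] at hZ
  rw [LieGroupoid.cS_cvec, ← cvec_zero, cvec_inj] at hW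
  rw [cOm, bilinBaseChange_cvec, om_eq_zero hZ.1 hW.1, om_eq_zero hZ.1 hW.2,
    om_eq_zero hZ.2 hW.1, om_eq_zero hZ.2 hW.2]
  simp

end SymplecticGroupoid

/-! ### Polarizations and the radical of ω on Tᵗ ∩ E. -/

lemma finrank_map_add_finrank_ker_inf {K V W : Type*} [Field K] [AddCommGroup V] [Module K V]
    [FiniteDimensional K V] [AddCommGroup W] [Module K W] (f : V →ₗ[K] W) (P : Submodule K V) :
    Module.finrank K (P.map f) + Module.finrank K (LinearMap.ker f ⊓ P : Submodule K V) =
      Module.finrank K P := by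
  have h1 := LinearMap.finrank_range_add_finrank_ker (f.domRestrict P)
  have h2 : (LinearMap.ker (f.domRestrict P)).map P.subtype = LinearMap.ker f ⊓ P := by
    ext x
    simp [Submodule.mem_map, and_comm]
  rw [← h2, ← (Submodule.equivMapOfInjective P.subtype P.injective_subtype _).finrank_eq]
  rwa [LinearMap.range_domRestrict] at h1

lemma conj_mem_sup {V : Type*} [AddCommGroup V] [Module ℝ V] {P : Submodule ℂ (ℂ ⊗[ℝ] V)}
    {Z : ℂ ⊗[ℝ] V} (hZ : Z ∈ P ⊔ conjSubspace P) : conj V Z ∈ P ⊔ conjSubspace P := by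
  obtain ⟨p, hp, q, hq, rfl⟩ := Submodule.mem_sup.1 hZ
  rw [map_add]
  exact Submodule.add_mem _ (Submodule.mem_sup_right (Submodule.mem_map_of_mem hp))
    (Submodule.mem_sup_left (mem_conjSubspace.1 hq))

/-- P + P̄ is stable under conjugation, hence contains real and imaginary parts. -/
lemma mem_subE_of_cvec_mem {V : Type*} [AddCommGroup V] [Module ℝ V]
    {P : Submodule ℂ (ℂ ⊗[ℝ] V)} {X Y : V} (h : cvec X Y ∈ P ⊔ conjSubspace P) :
    X ∈ subE P ∧ Y ∈ subE P := by
  have h1 := conj_mem_sup h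
  constructor
  · change (1 : ℂ) ⊗ₜ[ℝ] X ∈ P ⊔ conjSubspace P
    rw [cvec_add_conj X Y]
    exact Submodule.smul_mem _ _ (Submodule.add_mem _ h h1)
  · change (1 : ℂ) ⊗ₜ[ℝ] Y ∈ P ⊔ conjSubspace P
    rw [cvec_sub_conj X Y]
    exact Submodule.smul_mem _ _ (Submodule.sub_mem _ h h1)

namespace SymplecticGroupoid

variable {EG : Type*} [NormedAddCommGroup EG] [NormedSpace ℝ EG]
  {EM : Type*} [NormedAddCommGroup EM] [NormedSpace ℝ EM]
  {G : Type*} [TopologicalSpace G] [ChartedSpace EG G] [IsManifold 𝓘(ℝ, EG) ∞ G]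
  {M : Type*} [TopologicalSpace M] [ChartedSpace EM M]
  (S : SymplecticGroupoid EG EM G M)

/-- The pointwise properties of a polarization for which `Tᵗ_ℂ Σ ∩ P` has constant rank `r`,
expressed in the model spaces. -/
structure PolarizationAux (P : G → Submodule ℂ (ℂ ⊗[ℝ] EG)) (r : ℕ) : Prop where
  multiplicative : ∀ γ η : G, S.s γ = S.t η → ∀ V, V ∈ P (S.mul γ η) ↔
    ∃ Z ∈ P γ, ∃ W ∈ P η, S.cS γ Z = S.cT η W ∧ S.cM γ η (Z, W) = V
  hermitian : ∀ γ, ∀ Z ∈ P γ, conj EG (S.cI γ Z) ∈ P (S.inv γ)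
  lagrangian : ∀ γ Z, Z ∈ P γ ↔ ∀ W ∈ P γ, S.cOm γ Z W = 0
  rank : ∀ γ, Module.finrank ℂ (LinearMap.ker (S.cT γ) ⊓ P γ : Submodule ℂ (ℂ ⊗[ℝ] EG)) = r

variable {S}

/-- Each tangent space unfolds to the model space, so vectors at propositionally equal points such
as γ · 1 and γ can be compared by rewriting. -/
lemma IsPolarization.polarizationAux
    {P : ∀ g : G, Submodule ℂ (ℂ ⊗[ℝ] TangentSpace 𝓘(ℝ, EG) g)} (hP : S.IsPolarization P) {r : ℕ}
    (hr : ∀ g : G, Module.finrank ℂ (S.toLieGroupoid.TtC g ⊓ P g : Submodule ℂ _) = r) :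
    S.PolarizationAux P r where
  multiplicative γ η h V := hP.multiplicative γ η h V
  hermitian γ Z hZ := by
    have h1 : cderiv S.inv γ Z ∈ conjSubspace (P (S.inv γ)) := by
      rw [← hP.hermitian γ]
      exact Submodule.mem_map_of_mem hZ
    exact mem_conjSubspace.1 h1
  lagrangian γ Z := hP.lagrangian γ Z
  rank γ := hr γ

lemma TtD_le_TtE (P : ∀ g : G, Submodule ℂ (ℂ ⊗[ℝ] TangentSpace 𝓘(ℝ, EG) g)) (g : G) :
    S.TtD P g ≤ S.TtE P g := fun _ hX => ⟨hX.1, Submodule.mem_sup_left hX.2.1⟩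

namespace PolarizationAux

variable {P : G → Submodule ℂ (ℂ ⊗[ℝ] EG)} {r : ℕ} (hP : S.PolarizationAux P r)
include hP

lemma isotropic {γ : G} {Z W : ℂ ⊗[ℝ] EG} (hZ : Z ∈ P γ) (hW : W ∈ P γ) : S.cOm γ Z W = 0 :=
  (hP.lagrangian γ Z).1 hZ W hW

lemma isotropic_conj {γ : G} {Z W : ℂ ⊗[ℝ] EG} (hZ : conj EG Z ∈ P γ) (hW : conj EG W ∈ P γ) :
    S.cOm γ Z W = 0 := by
  have h1 := hP.isotropic hZ hW
  rw [cOm, bilinBaseChange_conj] at h1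
  exact (map_eq_zero _).1 h1

lemma cOm_eq_zero_of_mem {γ : G} {X W : ℂ ⊗[ℝ] EG} (hX : X ∈ P γ ⊓ conjSubspace (P γ))
    (hW : W ∈ P γ ⊔ conjSubspace (P γ)) : S.cOm γ X W = 0 := by
  obtain ⟨p, hp, q, hq, rfl⟩ := Submodule.mem_sup.1 hW
  rw [map_add, hP.isotropic hX.1 hp,
    hP.isotropic_conj (mem_conjSubspace.1 hX.2) (mem_conjSubspace.1 hq), add_zero]

variable [FiniteDimensional ℝ EG]

lemma two_mul_finrank (γ : G) : 2 * Module.finrank ℂ (P γ) = Module.finrank ℝ EG :=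
  finrank_of_isLagrangian (om_isAlt γ) (om_nondegenerate γ) (hP.lagrangian γ)

variable [FiniteDimensional ℝ EM] [IsManifold 𝓘(ℝ, EM) ∞ M]

lemma map_cT_mul_le {γ η : G} (h : S.s γ = S.t η) :
    (P (S.mul γ η)).map (S.cT (S.mul γ η)) ≤ (P γ).map (S.cT γ) := by
  rintro _ ⟨V, hV, rfl⟩
  obtain ⟨Z, hZ, W, hW, hZW, rfl⟩ := (hP.multiplicative γ η h V).1 hV
  exact ⟨Z, hZ, (LieGroupoid.cT_cM h hZW).symm⟩

/-- Multiplicativity over γγ⁻¹ gives one inclusion; both sides have dimension ½ dim Σ − r, so it is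
an equality. This is where constant rank is used. -/
lemma map_cT_eq (γ : G) :
    (P γ).map (S.cT γ) = (P (S.unit (S.t γ))).map (S.cT (S.unit (S.t γ))) := by
  have h1 := hP.map_cT_mul_le (γ := γ) (η := S.inv γ) (S.t_inv γ).symm
  rw [S.mul_inv] at h1
  refine (Submodule.eq_of_le_of_finrank_eq h1 ?_).symm
  have h2 := finrank_map_add_finrank_ker_inf (S.cT γ) (P γ)
  have h3 := finrank_map_add_finrank_ker_inf (S.cT (S.unit (S.t γ))) (P (S.unit (S.t γ)))
  have h4 := hP.two_mul_finrank γ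
  have h5 := hP.two_mul_finrank (S.unit (S.t γ))
  rw [hP.rank] at h2 h3
  omega

/-- Lift u to P at γ⁻¹ by `map_cT_eq`, then apply T inv and conjugate: T inv exchanges source and
target and carries P to P̄. -/
lemma exists_cS_eq {γ : G} {u : ℂ ⊗[ℝ] EM}
    (hu : u ∈ (P (S.unit (S.s γ))).map (S.cT (S.unit (S.s γ)))) :
    ∃ Z ∈ P γ, S.cS γ Z = conj EM u := by
  have h1 := hP.map_cT_eq (S.inv γ)
  rw [S.t_inv] at h1
  rw [← h1] at hu
  obtain ⟨W, hW, rfl⟩ := hu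
  have h2 := hP.hermitian _ W hW
  rw [S.inv_inv] at h2
  refine ⟨_, h2, ?_⟩
  have h3 := LieGroupoid.cS_cI (𝒢 := S.toLieGroupoid) (S.inv γ) W
  rw [S.inv_inv] at h3
  rw [← LieGroupoid.conj_cS, h3]

/-- Choose W in P with Tt W = u and Z in P with Ts Z = u. At a unit their product is Z + W − u, with
u seen as tangent to the units, and it lies in P; hence so does u. -/
lemma cU_mem {x : M} {u : ℂ ⊗[ℝ] EM} (hu : u ∈ (P (S.unit x)).map (S.cT (S.unit x)))
    (hu' : conj EM u ∈ (P (S.unit x)).map (S.cT (S.unit x))) : S.cU x u ∈ P (S.unit x) := by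
  have hst : S.s (S.unit x) = S.t (S.unit x) := by rw [S.s_unit, S.t_unit]
  have hmul : S.mul (S.unit x) (S.unit x) = S.unit x := by
    have := S.mul_unit (S.unit x)
    rwa [S.s_unit] at this
  obtain ⟨W, hW, rfl⟩ := hu
  obtain ⟨Z, hZ, hZW⟩ := hP.exists_cS_eq (γ := S.unit x) (by rwa [S.s_unit])
  rw [conj_conj] at hZW
  have hV := (hP.multiplicative _ _ hst _).2 ⟨Z, hZ, W, hW, hZW, rfl⟩
  rw [hmul] at hV
  set u := S.cT (S.unit x) W
  have h1 := LieGroupoid.cM_cU_right (𝒢 := S.toLieGroupoid) (S.unit x) Z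
  rw [S.s_unit, hZW] at h1
  have h2 := LieGroupoid.cM_cU_left (𝒢 := S.toLieGroupoid) (S.unit x) (W - S.cU x u)
  rw [S.t_unit, map_sub, LieGroupoid.cT_cU, sub_self, map_zero] at h2
  have h3 : ((Z, W) : (ℂ ⊗[ℝ] EG) × (ℂ ⊗[ℝ] EG)) = (Z, S.cU x u) + (0, W - S.cU x u) := by
    simp
  rw [h3, map_add, h1, h2] at hV
  have h4 := (P (S.unit x)).sub_mem ((P (S.unit x)).add_mem hZ hW) hV
  convert h4 using 1
  abel

/-- The unit vector over u lies in P and factors over γγ⁻¹ as Z · W. Left cancellation forces W = T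
inv Z, and the Hermitian condition on W then says that Z̄ lies in P. -/
lemma exists_real_lift {γ : G} {u : ℂ ⊗[ℝ] EM} (hu : u ∈ (P γ).map (S.cT γ))
    (hu' : conj EM u ∈ (P γ).map (S.cT γ)) :
    ∃ Z ∈ P γ, conj EG Z ∈ P γ ∧ S.cT γ Z = u := by
  rw [hP.map_cT_eq] at hu hu'
  have h1 := hP.cU_mem hu hu'
  rw [← S.mul_inv] at h1
  have hst := (S.t_inv γ).symm
  obtain ⟨Z, hZ, W, hW, hZW, hZWu⟩ := (hP.multiplicative γ (S.inv γ) hst _).1 h1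
  have hTZ : S.cT γ Z = u := by
    rw [← LieGroupoid.cT_cM hst hZW, hZWu, S.mul_inv, LieGroupoid.cT_cU]
  have hW' : W = S.cI γ Z := by
    rw [← sub_eq_zero]
    refine eq_zero_of_cM_eq_zero hst ?_ ?_
    · rw [map_sub, ← hZW, LieGroupoid.cT_cI, sub_self]
    · have h2 : ((0, W - S.cI γ Z) : (ℂ ⊗[ℝ] EG) × (ℂ ⊗[ℝ] EG)) = (Z, W) - (Z, S.cI γ Z) := by
        simp
      rw [h2, map_sub, hZWu, LieGroupoid.cM_cI, hTZ, sub_self]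
  have h3 := hP.hermitian _ W hW
  rw [S.inv_inv, hW', LieGroupoid.cI_cI] at h3
  exact ⟨Z, hZ, h3, hTZ⟩

/-- `Tᵗ_ℂ Σ ∩ (P + P̄) = (Tᵗ_ℂ Σ ∩ P) + (Tᵗ_ℂ Σ ∩ P̄)`. -/
lemma exists_decomposition {γ : G} {X : ℂ ⊗[ℝ] EG} (hX : X ∈ P γ ⊔ conjSubspace (P γ))
    (hTX : S.cT γ X = 0) :
    ∃ a b, a ∈ P γ ∧ S.cT γ a = 0 ∧ conj EG b ∈ P γ ∧ S.cT γ b = 0 ∧ a + b = X := by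
  obtain ⟨p, hp, q, hq, rfl⟩ := Submodule.mem_sup.1 hX
  rw [mem_conjSubspace] at hq
  rw [map_add] at hTX
  have hpq : S.cT γ p = -S.cT γ q := eq_neg_of_add_eq_zero_left hTX
  obtain ⟨Z, hZ, hZ', hTZ⟩ := hP.exists_real_lift (Submodule.mem_map_of_mem hp) (by
    rw [hpq, map_neg, LieGroupoid.conj_cT]
    exact Submodule.neg_mem _ (Submodule.mem_map_of_mem hq))
  -- Z lies in P ∩ P̄ over the common value Tt p = −Tt q, so it makes both summands vertical without
  -- leaving P or P̄.
  refine ⟨p - Z, q + Z, (P γ).sub_mem hp hZ, by rw [map_sub, hTZ, sub_self], ?_, ?_, by abel⟩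
  · rw [map_add]
    exact (P γ).add_mem hq hZ'
  · rw [map_add, hTZ, add_comm, hTX]

/-- It suffices that a is orthogonal to W̄ for every W in P. Factor W over γ · 1 as Z · W₁: then W −
Z is in Tᵗ ∩ P, while Z̄ differs from some Z' in P by a vector of ker Ts. -/
lemma conj_mem {γ : G} {a : ℂ ⊗[ℝ] EG} (ha : a ∈ P γ) (hTa : S.cT γ a = 0)
    (horth : ∀ b, conj EG b ∈ P γ → S.cT γ b = 0 → S.cOm γ a b = 0) : conj EG a ∈ P γ := by
  rw [hP.lagrangian]
  intro W hW
  have hst : S.s γ = S.t (S.unit (S.s γ)) := (S.t_unit _).symm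
  have hW₀ := hW
  rw [← S.mul_unit γ] at hW
  obtain ⟨Z, hZ, W₁, hW₁, hZW, hV⟩ := (hP.multiplicative _ _ hst W).1 hW
  have hTW : S.cT γ W = S.cT γ Z := by
    have h1 := LieGroupoid.cT_cM hst hZW
    rwa [hV, S.mul_unit] at h1
  obtain ⟨Z', hZ', hSZ'⟩ := hP.exists_cS_eq (γ := γ) (Submodule.mem_map_of_mem hW₁)
  have h1 : S.cOm γ a (conj EG (W - Z)) = 0 := by
    refine horth _ ?_ ?_
    · rw [conj_conj]
      exact (P γ).sub_mem hW₀ hZ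
    · rw [← LieGroupoid.conj_cT, map_sub, hTW, sub_self, map_zero]
  have h2 : S.cOm γ a (conj EG Z - Z') = 0 := by
    refine cOm_eq_zero hTa ?_
    rw [map_sub, ← LieGroupoid.conj_cS, hSZ', hZW, sub_self]
  have h3 : S.cOm γ a (conj EG W) = 0 := by
    have h4 : conj EG W = conj EG (W - Z) + (conj EG Z - Z') + Z' := by
      rw [map_sub]; abel
    rw [h4, map_add, map_add, h1, h2, hP.isotropic ha hZ', add_zero, add_zero]
  -- Since ω is real, ω(ā, W) is the conjugate of ω(a, W̄).
  have h5 := bilinBaseChange_conj (S.om γ) a (conj EG W)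
  rw [conj_conj] at h5
  rw [cOm, h5]
  exact (map_eq_zero _).2 h3

/-- The radical of `ω` on `Tᵗ_ℂ Σ ∩ (P + P̄)` lies in `P ∩ P̄`. -/
lemma mem_of_orthogonal {γ : G} {X : ℂ ⊗[ℝ] EG} (hX : X ∈ P γ ⊔ conjSubspace (P γ))
    (hTX : S.cT γ X = 0)
    (horth : ∀ W ∈ P γ ⊔ conjSubspace (P γ), S.cT γ W = 0 → S.cOm γ X W = 0) :
    X ∈ P γ ⊓ conjSubspace (P γ) := by
  obtain ⟨a, b, ha, hTa, hb, hTb, rfl⟩ := hP.exists_decomposition hX hTX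
  have ha' : conj EG a ∈ P γ := by
    -- Against Tᵗ ∩ P̄ the summand b is invisible, P̄ being isotropic, so the condition on a + b
    -- passes to a. The argument for b is its conjugate.
    refine hP.conj_mem ha hTa fun b' hb' hTb' => ?_
    have h1 := horth b' (Submodule.mem_sup_right (mem_conjSubspace.2 hb')) hTb'
    rwa [map_add, LinearMap.add_apply, hP.isotropic_conj hb hb', add_zero] at h1
  have hb' : conj EG (conj EG b) ∈ P γ := by
    refine hP.conj_mem hb (by rw [← LieGroupoid.conj_cT, hTb, map_zero]) fun b' hb' hTb' => ?_
    have h1 := horth (conj EG b') (Submodule.mem_sup_left hb')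
      (by rw [← LieGroupoid.conj_cT, hTb', map_zero])
    rw [map_add, LinearMap.add_apply, hP.isotropic ha hb', zero_add] at h1
    have h2 := bilinBaseChange_conj (S.om γ) b (conj EG b')
    rw [conj_conj] at h2
    rw [cOm, h2]
    exact (map_eq_zero _).2 h1
  rw [conj_conj] at hb'
  refine ⟨(P γ).add_mem ha hb', mem_conjSubspace.2 ?_⟩
  rw [map_add]
  exact (P γ).add_mem ha' hb

/-- The radical of `ω` on `Tᵗ Σ ∩ E` is `Tᵗ Σ ∩ D`. -/
lemma orthogonal_iff_mem_subD {γ : G} {X : EG} (hTX : S.dT γ X = 0) (hX : X ∈ subE (P γ)) :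
    (∀ Y, S.dT γ Y = 0 ∧ Y ∈ subE (P γ) → S.om γ X Y = 0) ↔ X ∈ subD (P γ) := by
  have hX' : (1 : ℂ) ⊗ₜ[ℝ] X ∈ P γ ⊔ conjSubspace (P γ) := hX
  constructor
  · intro h
    suffices h' : (1 : ℂ) ⊗ₜ[ℝ] X ∈ P γ ⊓ conjSubspace (P γ) from h'
    refine hP.mem_of_orthogonal hX' ?_ fun W hW hTW => ?_
    · rw [← cvec_zero_right, LieGroupoid.cT_cvec, hTX, map_zero, cvec_zero]
    · obtain ⟨Y, Y', rfl⟩ := exists_eq_cvec W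
      rw [LieGroupoid.cT_cvec, ← cvec_zero, cvec_inj] at hTW
      obtain ⟨hY, hY'⟩ := mem_subE_of_cvec_mem hW
      rw [← cvec_zero_right, cOm, bilinBaseChange_cvec, h Y ⟨hTW.1, hY⟩, h Y' ⟨hTW.2, hY'⟩]
      simp
  · intro h Y hY
    have h1 : S.cOm γ ((1 : ℂ) ⊗ₜ[ℝ] X) ((1 : ℂ) ⊗ₜ[ℝ] Y) = 0 := hP.cOm_eq_zero_of_mem h hY.2
    rw [cOm, bilinBaseChange_tmul] at h1
    exact Complex.ofReal_eq_zero.1 h1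

end PolarizationAux

lemma IsPolarization.orthogonal_iff_mem_TtD [FiniteDimensional ℝ EG] [FiniteDimensional ℝ EM]
    [IsManifold 𝓘(ℝ, EM) ∞ M]
    {P : ∀ g : G, Submodule ℂ (ℂ ⊗[ℝ] TangentSpace 𝓘(ℝ, EG) g)} (hP : S.IsPolarization P) {r : ℕ}
    (hr : ∀ g : G, Module.finrank ℂ (S.toLieGroupoid.TtC g ⊓ P g : Submodule ℂ _) = r) (g : G) :
    ∀ X ∈ S.TtE P g, (∀ Y ∈ S.TtE P g, S.bilin g X Y = 0) ↔ X ∈ S.TtD P g := by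
  intro X hX
  have h1 := (hP.polarizationAux hr).orthogonal_iff_mem_subD (γ := g) (X := X) hX.1 hX.2
  exact ⟨fun h => ⟨hX.1, h1.1 h⟩, fun h => h1.2 h.2⟩

end SymplecticGroupoid

end SympGpd

end

theorem mainTheorem9
    {EG : Type*} [NormedAddCommGroup EG] [NormedSpace ℝ EG] [FiniteDimensional ℝ EG]
    {EM : Type*} [NormedAddCommGroup EM] [NormedSpace ℝ EM] [FiniteDimensional ℝ EM]
    {G : Type*} [TopologicalSpace G] [ChartedSpace EG G] [IsManifold 𝓘(ℝ, EG) ∞ G]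
    {M : Type*} [TopologicalSpace M] [ChartedSpace EM M] [IsManifold 𝓘(ℝ, EM) ∞ M]
    (S : SympGpd.SymplecticGroupoid EG EM G M)
    (P : ∀ g : G, Submodule ℂ (ℂ ⊗[ℝ] TangentSpace 𝓘(ℝ, EG) g))
    (hP : S.IsPolarization P)
    (hrank : ∃ r : ℕ, ∀ g : G,
      Module.finrank ℂ (S.toLieGroupoid.TtC g ⊓ P g : Submodule ℂ _) = r) :
    (∀ g : G, SympGpd.NondegenerateOnQuotient (S.bilin g) (S.TtE P g) (S.TtD P g)) ∧
    (∀ g : G, ∃ k : ℕ,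
      Module.finrank ℝ (S.TtE P g) = Module.finrank ℝ (S.TtD P g) + 2 * k ∧
      SympGpd.ContractionIso (S.bilin g) k (S.TtE P g) (S.TtD P g)) ∧
    ((∃ q : ℕ, ∀ g : G,
        Module.finrank ℝ (S.TtE P g) = Module.finrank ℝ (S.TtD P g) + q) →
      ∃ k : ℕ, ∀ g : G,
        Module.finrank ℝ (S.TtE P g) = Module.finrank ℝ (S.TtD P g) + 2 * k ∧
        SympGpd.ContractionIso (S.bilin g) k (S.TtE P g) (S.TtD P g)) := by
  obtain ⟨r, hr⟩ := hrank
  have hrad := hP.orthogonal_iff_mem_TtD hr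
  have halt : ∀ g : G, (S.bilin g).IsAlt := fun g X => S.symp.alternating g X
  have hiso := fun g : G =>
    SympGpd.exists_contractionIso (halt g) (SympGpd.SymplecticGroupoid.TtD_le_TtE P g) (hrad g)
  refine ⟨fun g => SympGpd.nondegenerateOnQuotient (halt g) (hrad g), hiso, ?_⟩
  rintro ⟨q, hq⟩
  -- At each point q is twice the k found there, so the division is exact and k is the same
  -- everywhere.
  refine ⟨q / 2, fun g => ?_⟩
  obtain ⟨k, hk, hc⟩ := hiso g
  have hkq : q / 2 = k := by
    have := hq g
    omega
  rw [hkq]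
  exact ⟨hk, hc⟩
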